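/- Let $q\in\mathbb{C}^\times$ be not a root of unity, let $n\ge 1$, and let $U_q=U_q(\mathfrak{gl}_n)$ be the $\mathbb{C}$-algebra with generators $E_k,F_k$ ($1\le k<n$), $L_i^{\pm1}$ ($1\le i\le n$), $K_k=L_kL_{k+1}^{-1}$, and relations: $L_iL_i^{-1}=L_i^{-1}L_i=1$, $L_iL_j=L_jL_i$, $L_iE_k=q^{(\varepsilon_k-\varepsilon_{k+1}|\varepsilon_i)}E_kL_i$, $L_iF_k=q^{-(\varepsilon_k-\varepsilon_{k+1}|\varepsilon_i)}F_kL_i$, $E_jF_k-F_kE_j=\delta_{jk}\frac{K_k-K_k^{-1}}{q-q^{-1}}$, $E_jE_k=E_kE_j$ and $F_jF_k=F_kF_j$ if $|j-k|>1$, and $E_j^2E_k-(q+q^{-1})E_jE_kE_j+E_kE_j^2=0$ and $F_j^2F_k-(q+q^{-1})F_jF_kF_j+F_kF_j^2=0$ if $|j-k|=1$. Here $(\varepsilon_i|\varepsilon_j)=\delta_{ij}$. The coproduct is $\Delta(E_k)=E_k\otimes1+K_k\otimes E_k$, $\Delta(F_k)=F_k\otimes K_k^{-1}+1\otimes F_k$,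 $\Delta(L_i)=L_i\otimes L_i$. For $\lambda\in\bigoplus_i\mathbb{Z}\varepsilon_i$ let $L(\lambda)$ be the simple quotient of the Verma module of highest weight $\lambda$. Let $U^\pm_\nu$ ($\nu\in\mathbb{Z}_{\ge0}^{n-1}$) be the span of the products of the $E_k$ (resp. $F_k$) containing the $k$-th generator $\nu_k$ times. Let $\mathcal{O}$ be the category of finitely generated $U_q$-modules $M$ that are the direct sum of their weight spaces $M_\lambda=\{v : L_iv=q^{(\lambda|\varepsilon_i)}v \text{ for all } i\}$, $\lambda\in\bigoplus_i\mathbb{Z}\varepsilon_i$, these being finite-dimensional, and in which $U_q^+v$ is finite-dimensional for every $v\in M$, where $U_q^+$ is the subalgebra generated by the $E_k$. For a family of elements $P_\nu\in U_q\otimes U_q$ let $$\mathcal{R}^P_{XY}\colon X\otimes Y\to Y\otimes X,\qquad x\mapsto \Pi^{-1}\Big(\sum_\nu P_\nu x\Big),$$ where $\Pi^{-1}(v\otimes w)=q^{(\lambda|\mu)}w\otimes v$ for $v\in X_\lambda$, $w\in Y_\mu$. An $R$-matrix family is a family $P_\nu\in U^-_\nu\otimes U^+_\nu$ with $P_0=1\otimes1$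 such that $\mathcal{R}^P_{XY}$ is an isomorphism of $U_q$-modules for all $X,Y\in\mathcal{O}$. Let $P_\nu$ now be the component of degree $\nu$ of the product $$\prod_{i<j}\ \sum_{m\ge0} q^{m(m-1)/2}\,\frac{(q-q^{-1})^m}{[m]!}\,F_{ij}^m\otimes E_{ij}^m,\qquad [m]!=\prod_{k=1}^m\frac{q^k-q^{-k}}{q-q^{-1}},$$ over the pairs $1\le i<j\le n$ in lexicographic order, where $E_{i,i+1}=E_i$, $F_{i,i+1}=F_i$, $E_{i,j+1}=E_{ij}E_j-q^{-1}E_jE_{ij}$, $F_{i,j+1}=F_jF_{ij}-qF_{ij}F_j$. Let $V=L(\varepsilon_1)$ and let $\mathcal{R}_{VV}$ be the resulting map $V\otimes V\to V\otimes V$. Then: 1. $\mathcal{R}^{P'}_{VV}=\mathcal{R}_{VV}$ for every $R$-matrix family $P'$. 2. $\mathcal{R}_{VV}$ is an automorphism of the $U_q$-module $V\otimes V$. 3. $(\mathcal{R}_{VV}-q)\circ(\mathcal{R}_{VV}+q^{-1})=0$. 4. $V\otimes V=A\oplus B$ for $U_q$-submodules $A,B$ with $A\cong L(2\varepsilon_1)$,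 with $B\cong L(\varepsilon_1+\varepsilon_2)$ if $n\ge2$, and with $B=0$ if $n=1$; the map $\mathcal{R}_{VV}$ is multiplication by $q$ on $A$ and by $-q^{-1}$ on $B$. -/

import Mathlib

open scoped TensorProduct

noncomputable section

namespace QuantumGL

/-! ### The algebra `U_q(gl_n)` -/

section Presentation

variable (n : ℕ)

/-- The node `k` of the Dynkin diagram of `gl_n` joins the coordinates `lo k` and `hi k`
(that is, `k` and `k + 1`). All indices start at `0`. -/
def lo {n : ℕ} (k : Fin (n - 1)) : Fin n := ⟨k, by omega⟩

/-- The upper coordinate joined by the node `k`, see `lo`. -/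
def hi {n : ℕ} (k : Fin (n - 1)) : Fin n := ⟨k + 1, by omega⟩

/-- The weight lattice `P = ℤ ε_1 ⊕ ⋯ ⊕ ℤ ε_n`. -/
abbrev Weight := Fin n → ℤ

/-- The weight `ε_i`. -/
def eps {n : ℕ} (i : Fin n) : Weight n := Pi.single i 1

/-- The form on `P` with `(ε_i | ε_j) = δ_{ij}`. -/
def form {n : ℕ} (a b : Weight n) : ℤ := ∑ i, a i * b i

/-- The simple root `ε_k - ε_{k+1}`. -/
def simpleRoot {n : ℕ} (k : Fin (n - 1)) : Weight n := eps (lo k) - eps (hi k)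

/-- Names of the generators `E_k`, `F_k`, `L_i`, `L_i⁻¹`. -/
inductive Gen
  | E (k : Fin (n - 1))
  | F (k : Fin (n - 1))
  | L (i : Fin n)
  | Linv (i : Fin n)

variable {n}

/-- The generator named `g` in the free algebra. -/
abbrev fr (g : Gen n) : FreeAlgebra ℂ (Gen n) := FreeAlgebra.ι ℂ g

/-- `K_k = L_k L_{k+1}⁻¹` in the free algebra. -/
abbrev frK (k : Fin (n - 1)) : FreeAlgebra ℂ (Gen n) := fr (.L (lo k)) * fr (.Linv (hi k))

/-- `K_k⁻¹ = L_{k+1} L_k⁻¹` in the free algebra. -/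
abbrev frKinv (k : Fin (n - 1)) : FreeAlgebra ℂ (Gen n) := fr (.L (hi k)) * fr (.Linv (lo k))

/-- The nodes `j` and `k` are neighbours in the Dynkin diagram. -/
def Adjacent (j k : Fin (n - 1)) : Prop := (j : ℕ) + 1 = k ∨ (k : ℕ) + 1 = j

/-- The nodes `j` and `k` are distinct and not neighbours in the Dynkin diagram. -/
def Distant (j k : Fin (n - 1)) : Prop := (j : ℕ) + 1 < k ∨ (k : ℕ) + 1 < j

/-- The expression `x² y - (q + q⁻¹) x y x + y x²`. -/
def serre {A : Type*} [Ring A] [Algebra ℂ A] (q : ℂˣ) (x y : A) : A :=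
  x * x * y - ((q : ℂ) + (q : ℂ)⁻¹) • (x * y * x) + y * x * x

/-- The defining relations of `U_q(gl_n)`. -/
inductive Rel (n : ℕ) (q : ℂˣ) : FreeAlgebra ℂ (Gen n) → FreeAlgebra ℂ (Gen n) → Prop
  | L_Linv (i : Fin n) : Rel n q (fr (.L i) * fr (.Linv i)) 1
  | Linv_L (i : Fin n) : Rel n q (fr (.Linv i) * fr (.L i)) 1
  | L_L (i j : Fin n) : Rel n q (fr (.L i) * fr (.L j)) (fr (.L j) * fr (.L i))
  | L_E (i : Fin n) (k : Fin (n - 1)) : Rel n q (fr (.L i) * fr (.E k))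
      ((q : ℂ) ^ form (simpleRoot k) (eps i) • (fr (.E k) * fr (.L i)))
  | L_F (i : Fin n) (k : Fin (n - 1)) : Rel n q (fr (.L i) * fr (.F k))
      ((q : ℂ) ^ (-form (simpleRoot k) (eps i)) • (fr (.F k) * fr (.L i)))
  | E_F_ne (j k : Fin (n - 1)) (h : j ≠ k) :
      Rel n q (fr (.E j) * fr (.F k)) (fr (.F k) * fr (.E j))
  | E_F_eq (k : Fin (n - 1)) : Rel n q (fr (.E k) * fr (.F k))
      (fr (.F k) * fr (.E k) + ((q : ℂ) - (q : ℂ)⁻¹)⁻¹ • (frK k - frKinv k))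
  | E_E (j k : Fin (n - 1)) (h : Distant j k) :
      Rel n q (fr (.E j) * fr (.E k)) (fr (.E k) * fr (.E j))
  | F_F (j k : Fin (n - 1)) (h : Distant j k) :
      Rel n q (fr (.F j) * fr (.F k)) (fr (.F k) * fr (.F j))
  | serre_E (j k : Fin (n - 1)) (h : Adjacent j k) :
      Rel n q (serre q (fr (.E j)) (fr (.E k))) 0
  | serre_F (j k : Fin (n - 1)) (h : Adjacent j k) :
      Rel n q (serre q (fr (.F j)) (fr (.F k))) 0

end Presentation

/-- The quantum group `U_q(gl_n)` over `ℂ`. -/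
def Uq (n : ℕ) (q : ℂˣ) : Type := RingQuot (Rel n q)

instance (n : ℕ) (q : ℂˣ) : Ring (Uq n q) := inferInstanceAs (Ring (RingQuot (Rel n q)))

instance (n : ℕ) (q : ℂˣ) : Algebra ℂ (Uq n q) :=
  inferInstanceAs (Algebra ℂ (RingQuot (Rel n q)))

section Generators

variable {n : ℕ} {q : ℂˣ}

/-- The projection from the free algebra to `U_q(gl_n)`. -/
def toUq (n : ℕ) (q : ℂˣ) : FreeAlgebra ℂ (Gen n) →ₐ[ℂ] Uq n q := RingQuot.mkAlgHom ℂ (Rel n q)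

theorem toUq_rel {x y : FreeAlgebra ℂ (Gen n)} (h : Rel n q x y) : toUq n q x = toUq n q y :=
  RingQuot.mkAlgHom_rel ℂ h

/-- The element `E_k`. -/
def E (k : Fin (n - 1)) : Uq n q := toUq n q (fr (.E k))

/-- The element `F_k`. -/
def F (k : Fin (n - 1)) : Uq n q := toUq n q (fr (.F k))

/-- The element `L_i`. -/
def L (i : Fin n) : Uq n q := toUq n q (fr (.L i))

/-- The element `L_i⁻¹`. -/
def Linv (i : Fin n) : Uq n q := toUq n q (fr (.Linv i))

/-- The element `K_k = L_k L_{k+1}⁻¹`. -/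
def K (k : Fin (n - 1)) : Uq n q := L (lo k) * Linv (hi k)

/-- The element `K_k⁻¹ = L_{k+1} L_k⁻¹`. -/
def Kinv (k : Fin (n - 1)) : Uq n q := L (hi k) * Linv (lo k)

end Generators

/-! ### The relations, stated in `U_q(gl_n)` -/

section Relations

variable {n : ℕ} {q : ℂˣ}

theorem L_mul_Linv (i : Fin n) : (L i * Linv i : Uq n q) = 1 := by
  simpa [L, Linv] using toUq_rel (Rel.L_Linv (q := q) i)

theorem Linv_mul_L (i : Fin n) : (Linv i * L i : Uq n q) = 1 := by
  simpa [L, Linv] using toUq_rel (Rel.Linv_L (q := q) i)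

theorem L_comm (i j : Fin n) : (L i * L j : Uq n q) = L j * L i := by
  simpa [L] using toUq_rel (Rel.L_L (q := q) i j)

theorem L_E (i : Fin n) (k : Fin (n - 1)) : (L i * E k : Uq n q) =
    (q : ℂ) ^ form (simpleRoot k) (eps i) • (E k * L i) := by
  simpa [L, E] using toUq_rel (Rel.L_E (q := q) i k)

theorem L_F (i : Fin n) (k : Fin (n - 1)) : (L i * F k : Uq n q) =
    (q : ℂ) ^ (-form (simpleRoot k) (eps i)) • (F k * L i) := by
  simpa [L, F] using toUq_rel (Rel.L_F (q := q) i k)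

theorem E_F_ne {j k : Fin (n - 1)} (h : j ≠ k) : (E j * F k : Uq n q) = F k * E j := by
  simpa [E, F] using toUq_rel (Rel.E_F_ne (q := q) j k h)

theorem E_F_eq (k : Fin (n - 1)) : (E k * F k : Uq n q) =
    F k * E k + ((q : ℂ) - (q : ℂ)⁻¹)⁻¹ • (K k - Kinv k) := by
  simpa [E, F, K, Kinv, L, Linv] using toUq_rel (Rel.E_F_eq (q := q) k)

theorem E_comm {j k : Fin (n - 1)} (h : Distant j k) : (E j * E k : Uq n q) = E k * E j := by
  simpa [E] using toUq_rel (Rel.E_E (q := q) j k h)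

theorem F_comm {j k : Fin (n - 1)} (h : Distant j k) : (F j * F k : Uq n q) = F k * F j := by
  simpa [F] using toUq_rel (Rel.F_F (q := q) j k h)

theorem serre_E {j k : Fin (n - 1)} (h : Adjacent j k) :
    serre q (E j : Uq n q) (E k) = 0 := by
  simpa [E, serre] using toUq_rel (Rel.serre_E (q := q) j k h)

theorem serre_F {j k : Fin (n - 1)} (h : Adjacent j k) :
    serre q (F j : Uq n q) (F k) = 0 := by
  simpa [F, serre] using toUq_rel (Rel.serre_F (q := q) j k h)

/-- If `l` scales `x` by `c` and has the inverse `l'`, then `l'` scales `x` by `c⁻¹`. -/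
theorem inv_scale {A : Type*} [Ring A] [Algebra ℂ A] {l l' x : A} {c : ℂ} (hc : c ≠ 0)
    (h : l * l' = 1) (h' : l' * l = 1) (hx : l * x = c • (x * l)) :
    l' * x = c⁻¹ • (x * l') := by
  have h1 : l' * (l * x) * l' = c • (l' * (x * l) * l') := by rw [hx]; simp
  have h2 : l' * (l * x) * l' = x * l' := by rw [← mul_assoc, h', one_mul]
  have h3 : l' * (x * l) * l' = l' * x := by
    rw [mul_assoc, mul_assoc x, h, mul_one]
  rw [h2, h3] at h1
  rw [h1, smul_smul, inv_mul_cancel₀ hc, one_smul]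

/-- If `l` and `m` scale `x` by `c` and `d`, then `l m` scales `x` by `c d`. -/
theorem mul_scale {A : Type*} [Ring A] [Algebra ℂ A] {l m x : A} {c d : ℂ}
    (hl : l * x = c • (x * l)) (hm : m * x = d • (x * m)) :
    l * m * x = (c * d) • (x * (l * m)) := by
  rw [mul_assoc, hm, mul_smul_comm, ← mul_assoc, hl, smul_mul_assoc, smul_smul, mul_comm d,
    mul_assoc]

theorem Linv_L_comm (i j : Fin n) : (Linv i * L j : Uq n q) = L j * Linv i := by
  have h := inv_scale (c := 1) one_ne_zero (L_mul_Linv (q := q) i) (Linv_mul_L i)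
    (x := L j) (by rw [one_smul, L_comm])
  simpa using h

theorem Linv_comm (i j : Fin n) : (Linv i * Linv j : Uq n q) = Linv j * Linv i := by
  have h := inv_scale (c := 1) one_ne_zero (L_mul_Linv (q := q) i) (Linv_mul_L i)
    (x := Linv j) (by rw [one_smul, Linv_L_comm])
  simpa using h

theorem K_Kinv (k : Fin (n - 1)) : (K k * Kinv k : Uq n q) = 1 := by
  rw [K, Kinv, mul_assoc, ← mul_assoc (Linv _), Linv_mul_L, one_mul, L_mul_Linv]

theorem Kinv_K (k : Fin (n - 1)) : (Kinv k * K k : Uq n q) = 1 := by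
  rw [K, Kinv, mul_assoc, ← mul_assoc (Linv _), Linv_mul_L, one_mul, L_mul_Linv]

theorem K_comm (j k : Fin (n - 1)) : (K j * K k : Uq n q) = K k * K j := by
  have h1 := fun i => mul_scale (c := 1) (d := 1) (x := (L i : Uq n q)) (l := L (lo j))
    (m := Linv (hi j)) (by simp [L_comm _ i]) (by simp [Linv_L_comm _ i])
  have h2 := fun i => mul_scale (c := 1) (d := 1) (x := (Linv i : Uq n q)) (l := L (lo j))
    (m := Linv (hi j)) (by simp [Linv_L_comm i]) (by simp [Linv_comm _ i])
  simp only [mul_one, one_smul] at h1 h2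
  rw [K, K, ← mul_assoc, h1, mul_assoc, h2, ← mul_assoc]

theorem Kinv_K_comm (j k : Fin (n - 1)) : (Kinv j * K k : Uq n q) = K k * Kinv j := by
  simpa using inv_scale (c := 1) one_ne_zero (K_Kinv (q := q) j) (Kinv_K j)
    (x := K k) (by rw [one_smul, K_comm])

theorem Kinv_comm (j k : Fin (n - 1)) : (Kinv j * Kinv k : Uq n q) = Kinv k * Kinv j := by
  simpa using inv_scale (c := 1) one_ne_zero (K_Kinv (q := q) j) (Kinv_K j)
    (x := Kinv k) (by rw [one_smul, Kinv_K_comm])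

/-- The Cartan integer of the nodes `j` and `k`. -/
def cartan (j k : Fin (n - 1)) : ℤ := form (simpleRoot k) (eps (lo j)) -
  form (simpleRoot k) (eps (hi j))

theorem form_simpleRoot_eps (k : Fin (n - 1)) (i : Fin n) :
    form (simpleRoot k) (eps i) =
      (if (k : ℕ) = i then 1 else 0) - (if (k : ℕ) + 1 = i then 1 else 0) := by
  simp only [form, simpleRoot, eps, Pi.sub_apply, Pi.single_apply, mul_ite, mul_one, mul_zero,
    Finset.sum_ite_eq', Finset.mem_univ, if_true]
  simp only [Fin.ext_iff, lo, hi, eq_comm]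

theorem cartan_eq (j k : Fin (n - 1)) : cartan j k =
    ((if (k : ℕ) = j then 1 else 0) - (if (k : ℕ) + 1 = j then 1 else 0)) -
      ((if (k : ℕ) = j + 1 then 1 else 0) - (if (k : ℕ) + 1 = j + 1 then 1 else 0)) := by
  simp only [cartan, form_simpleRoot_eps, lo, hi]

theorem cartan_comm (j k : Fin (n - 1)) : cartan j k = cartan k j := by
  rw [cartan_eq, cartan_eq]; split_ifs <;> omega

theorem cartan_self (k : Fin (n - 1)) : cartan k k = 2 := by
  rw [cartan_eq]; split_ifs <;> omega

theorem cartan_adjacent {j k : Fin (n - 1)} (h : Adjacent j k) : cartan j k = -1 := by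
  rw [cartan_eq]; unfold Adjacent at h; split_ifs <;> omega

theorem cartan_distant {j k : Fin (n - 1)} (h : Distant j k) : cartan j k = 0 := by
  rw [cartan_eq]; unfold Distant at h; split_ifs <;> omega

theorem K_E (j k : Fin (n - 1)) : (K j * E k : Uq n q) =
    (q : ℂ) ^ cartan j k • (E k * K j) := by
  have h := mul_scale (L_E (q := q) (lo j) k) (inv_scale (zpow_ne_zero _ q.ne_zero)
    (L_mul_Linv (hi j)) (Linv_mul_L (hi j)) (L_E (hi j) k))
  rw [K, h, ← zpow_neg, ← zpow_add₀ q.ne_zero, cartan, sub_eq_add_neg]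

theorem K_F (j k : Fin (n - 1)) : (K j * F k : Uq n q) =
    (q : ℂ) ^ (-cartan j k) • (F k * K j) := by
  have h := mul_scale (L_F (q := q) (lo j) k) (inv_scale (zpow_ne_zero _ q.ne_zero)
    (L_mul_Linv (hi j)) (Linv_mul_L (hi j)) (L_F (hi j) k))
  rw [K, h, ← zpow_neg, ← zpow_add₀ q.ne_zero, cartan, neg_sub, sub_eq_add_neg, neg_neg,
    add_comm]

theorem Kinv_E (j k : Fin (n - 1)) : (Kinv j * E k : Uq n q) =
    (q : ℂ) ^ (-cartan j k) • (E k * Kinv j) := by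
  rw [inv_scale (zpow_ne_zero _ q.ne_zero) (K_Kinv j) (Kinv_K j) (K_E j k), zpow_neg]

theorem Kinv_F (j k : Fin (n - 1)) : (Kinv j * F k : Uq n q) =
    (q : ℂ) ^ cartan j k • (F k * Kinv j) := by
  rw [inv_scale (zpow_ne_zero _ q.ne_zero) (K_Kinv j) (Kinv_K j) (K_F j k), zpow_neg, inv_inv]

end Relations

/-! ### The coproduct -/

section Coproduct

variable {n : ℕ} {q : ℂˣ}

theorem serre_add {A : Type*} [Ring A] [Algebra ℂ A] {a b c d : A}
    (hba : b * a = (q : ℂ) ^ (2 : ℤ) • (a * b)) (hbc : b * c = (q : ℂ) ^ (-1 : ℤ) • (c * b))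
    (hda : d * a = (q : ℂ) ^ (-1 : ℤ) • (a * d)) (hac : serre q a c = 0)
    (hbd : serre q b d = 0) : serre q (a + b) (c + d) = 0 := by
  have hq : (q : ℂ) ≠ 0 := q.ne_zero
  simp only [zpow_neg, zpow_ofNat, pow_one] at hba hbc hda
  have hsplit : serre q (a + b) (c + d) = serre q a c + serre q b d + serre q b c + serre q a d +
      (a * b * c + b * a * c - ((q : ℂ) + (q : ℂ)⁻¹) • (a * c * b + b * c * a) +
        (c * a * b + c * b * a)) +
      (a * b * d + b * a * d - ((q : ℂ) + (q : ℂ)⁻¹) • (a * d * b + b * d * a) +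
        (d * a * b + d * b * a)) := by
    simp only [serre, mul_add, add_mul, smul_add]
    abel
  have e1 : b * c * b = (q : ℂ)⁻¹ • (c * b * b) := by rw [hbc, smul_mul_assoc]
  have e2 : b * b * c = ((q : ℂ)⁻¹ * (q : ℂ)⁻¹) • (c * b * b) := by
    rw [mul_assoc, hbc, mul_smul_comm, ← mul_assoc, e1, smul_smul]
  have e3 : d * a * a = ((q : ℂ)⁻¹ * (q : ℂ)⁻¹) • (a * a * d) := by
    rw [hda, smul_mul_assoc, mul_assoc, hda, mul_smul_comm, smul_smul, mul_assoc]
  have e4 : a * d * a = (q : ℂ)⁻¹ • (a * a * d) := by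
    rw [mul_assoc, hda, mul_smul_comm, mul_assoc]
  have e5 : a * b * c = (q : ℂ)⁻¹ • (a * c * b) := by
    rw [mul_assoc, hbc, mul_smul_comm, mul_assoc]
  have e6 : b * a * c = ((q : ℂ) ^ 2 * (q : ℂ)⁻¹) • (a * c * b) := by
    rw [hba, smul_mul_assoc, e5, smul_smul]
  have e7 : c * b * a = (q : ℂ) ^ 2 • (c * a * b) := by
    rw [mul_assoc, hba, mul_smul_comm, mul_assoc]
  have e8 : b * c * a = ((q : ℂ)⁻¹ * (q : ℂ) ^ 2) • (c * a * b) := by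
    rw [hbc, smul_mul_assoc, e7, smul_smul]
  have e9 : b * a * d = (q : ℂ) ^ 2 • (a * b * d) := by rw [hba, smul_mul_assoc]
  have e10 : b * d * a = ((q : ℂ)⁻¹ * (q : ℂ) ^ 2) • (a * b * d) := by
    rw [mul_assoc, hda, mul_smul_comm, ← mul_assoc, e9, smul_smul]
  have e11 : d * a * b = (q : ℂ)⁻¹ • (a * d * b) := by rw [hda, smul_mul_assoc]
  have e12 : d * b * a = ((q : ℂ) ^ 2 * (q : ℂ)⁻¹) • (a * d * b) := by
    rw [mul_assoc, hba, mul_smul_comm, ← mul_assoc, e11, smul_smul]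
  have f1 : serre q b c = 0 := by
    rw [serre, e1, e2]
    match_scalars
    field_simp
    ring
  have f2 : serre q a d = 0 := by
    have e3' : d * a * a = ((q : ℂ)⁻¹ * (q : ℂ)⁻¹) • (a * a * d) := e3
    rw [serre, e3', e4]
    match_scalars
    field_simp
    ring
  rw [hsplit, hac, hbd, f1, f2, e5, e6, e7, e8, e9, e10, e11, e12]
  match_scalars <;> field_simp <;> ring

/-- The values of the coproduct on the generators. -/
def comulGen (n : ℕ) (q : ℂˣ) : Gen n → Uq n q ⊗[ℂ] Uq n q
  | .E k => E k ⊗ₜ 1 + K k ⊗ₜ E k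
  | .F k => F k ⊗ₜ Kinv k + 1 ⊗ₜ F k
  | .L i => L i ⊗ₜ L i
  | .Linv i => Linv i ⊗ₜ Linv i

theorem comul_rel {x y : FreeAlgebra ℂ (Gen n)} (h : Rel n q x y) :
    FreeAlgebra.lift ℂ (comulGen n q) x = FreeAlgebra.lift ℂ (comulGen n q) y := by
  induction h with
  | L_Linv i =>
    simp [comulGen, L_mul_Linv, Algebra.TensorProduct.one_def]
  | Linv_L i =>
    simp [comulGen, Linv_mul_L, Algebra.TensorProduct.one_def]
  | L_L i j =>
    simp [comulGen, L_comm i j]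
  | L_E i k =>
    simp only [map_mul, map_smul, FreeAlgebra.lift_ι_apply, comulGen, mul_add, add_mul,
      Algebra.TensorProduct.tmul_mul_tmul, mul_one, one_mul, L_E]
    have h1 : (L i * K k : Uq n q) = K k * L i := by
      rw [K, mul_assoc, Linv_L_comm, ← mul_assoc, L_comm, mul_assoc]
    rw [h1, TensorProduct.tmul_smul, ← TensorProduct.smul_tmul', smul_add]
  | L_F i k =>
    simp only [map_mul, map_smul, FreeAlgebra.lift_ι_apply, comulGen, mul_add, add_mul,
      Algebra.TensorProduct.tmul_mul_tmul, mul_one, one_mul, L_F]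
    have h1 : (L i * Kinv k : Uq n q) = Kinv k * L i := by
      rw [Kinv, mul_assoc, Linv_L_comm, ← mul_assoc, L_comm, mul_assoc]
    rw [h1, TensorProduct.tmul_smul, ← TensorProduct.smul_tmul', smul_add]
  | E_F_ne j k h =>
    simp only [map_mul, FreeAlgebra.lift_ι_apply, comulGen, mul_add, add_mul,
      Algebra.TensorProduct.tmul_mul_tmul, mul_one, one_mul, E_F_ne h, K_F]
    have h1 : (Kinv k * E j : Uq n q) = (q : ℂ) ^ (-cartan j k) • (E j * Kinv k) := by
      rw [Kinv_E, cartan_comm]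
    rw [h1, TensorProduct.tmul_smul, TensorProduct.smul_tmul']
    abel
  | E_F_eq k =>
    simp only [map_mul, map_add, map_sub, map_smul, FreeAlgebra.lift_ι_apply, comulGen, mul_add,
      add_mul, Algebra.TensorProduct.tmul_mul_tmul, mul_one, one_mul, E_F_eq, K_F, Kinv_E]
    have hK : (L (lo k) * Linv (hi k) : Uq n q) = K k := rfl
    have hKinv : (L (hi k) * Linv (lo k) : Uq n q) = Kinv k := rfl
    simp only [hK, hKinv, TensorProduct.tmul_smul, ← TensorProduct.smul_tmul',
      TensorProduct.add_tmul, TensorProduct.tmul_add, TensorProduct.sub_tmul,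
      TensorProduct.tmul_sub, smul_sub]
    abel
  | E_E j k h =>
    simp only [map_mul, FreeAlgebra.lift_ι_apply, comulGen, mul_add, add_mul,
      Algebra.TensorProduct.tmul_mul_tmul, mul_one, one_mul, E_comm h, K_E, K_comm j k,
      cartan_distant h, cartan_comm k j, zpow_zero, one_smul]
    abel
  | F_F j k h =>
    simp only [map_mul, FreeAlgebra.lift_ι_apply, comulGen, mul_add, add_mul,
      Algebra.TensorProduct.tmul_mul_tmul, mul_one, one_mul, F_comm h, Kinv_F, Kinv_comm j k,
      cartan_distant h, cartan_comm k j, zpow_zero, one_smul]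
    abel
  | serre_E j k h =>
    have key : serre q (E j ⊗ₜ[ℂ] 1 + K j ⊗ₜ[ℂ] E j : Uq n q ⊗[ℂ] Uq n q)
        (E k ⊗ₜ[ℂ] 1 + K k ⊗ₜ[ℂ] E k) = 0 := by
      apply serre_add
      · simp only [Algebra.TensorProduct.tmul_mul_tmul, mul_one, one_mul, K_E, cartan_self,
          TensorProduct.smul_tmul']
      · simp only [Algebra.TensorProduct.tmul_mul_tmul, mul_one, one_mul, K_E, cartan_adjacent h,
          TensorProduct.smul_tmul']
      · simp only [Algebra.TensorProduct.tmul_mul_tmul, mul_one, one_mul, K_E, cartan_comm k j,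
          cartan_adjacent h, TensorProduct.smul_tmul']
      · have h0 := serre_E (q := q) h
        simp only [serre] at h0 ⊢
        simp only [Algebra.TensorProduct.tmul_mul_tmul, mul_one]
        rw [TensorProduct.smul_tmul', ← TensorProduct.sub_tmul, ← TensorProduct.add_tmul, h0,
          TensorProduct.zero_tmul]
      · have h0 := serre_E (q := q) h
        simp only [serre] at h0 ⊢
        simp only [Algebra.TensorProduct.tmul_mul_tmul]
        have h1 : (K j * K k * K j : Uq n q) = K j * K j * K k := by
          rw [mul_assoc, K_comm k j, mul_assoc]
        have h2 : (K k * K j * K j : Uq n q) = K j * K j * K k := by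
          rw [K_comm k j, mul_assoc, K_comm k j, mul_assoc]
        rw [h1, h2, ← TensorProduct.tmul_smul, ← TensorProduct.tmul_sub,
          ← TensorProduct.tmul_add, h0, TensorProduct.tmul_zero]
    simpa [serre, comulGen] using key
  | serre_F j k h =>
    have key : serre q (1 ⊗ₜ[ℂ] F j + F j ⊗ₜ[ℂ] Kinv j : Uq n q ⊗[ℂ] Uq n q)
        (1 ⊗ₜ[ℂ] F k + F k ⊗ₜ[ℂ] Kinv k) = 0 := by
      apply serre_add
      · simp only [Algebra.TensorProduct.tmul_mul_tmul, mul_one, one_mul, Kinv_F, cartan_self,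
          TensorProduct.tmul_smul]
      · simp only [Algebra.TensorProduct.tmul_mul_tmul, mul_one, one_mul, Kinv_F,
          cartan_adjacent h, TensorProduct.tmul_smul]
      · simp only [Algebra.TensorProduct.tmul_mul_tmul, mul_one, one_mul, Kinv_F,
          cartan_comm k j, cartan_adjacent h, TensorProduct.tmul_smul]
      · have h0 := serre_F (q := q) h
        simp only [serre] at h0 ⊢
        simp only [Algebra.TensorProduct.tmul_mul_tmul, mul_one]
        rw [← TensorProduct.tmul_smul, ← TensorProduct.tmul_sub, ← TensorProduct.tmul_add, h0,
          TensorProduct.tmul_zero]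
      · have h0 := serre_F (q := q) h
        simp only [serre] at h0 ⊢
        simp only [Algebra.TensorProduct.tmul_mul_tmul]
        have h1 : (Kinv j * Kinv k * Kinv j : Uq n q) = Kinv j * Kinv j * Kinv k := by
          rw [mul_assoc, Kinv_comm k j, mul_assoc]
        have h2 : (Kinv k * Kinv j * Kinv j : Uq n q) = Kinv j * Kinv j * Kinv k := by
          rw [Kinv_comm k j, mul_assoc, Kinv_comm k j, mul_assoc]
        rw [h1, h2, TensorProduct.smul_tmul', ← TensorProduct.sub_tmul,
          ← TensorProduct.add_tmul, h0, TensorProduct.zero_tmul]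
    simpa [serre, comulGen, add_comm] using key

/-- The coproduct `Δ : U_q → U_q ⊗ U_q`, with `Δ(E_k) = E_k ⊗ 1 + K_k ⊗ E_k`,
`Δ(F_k) = F_k ⊗ K_k⁻¹ + 1 ⊗ F_k` and `Δ(L_i) = L_i ⊗ L_i`. -/
def comul (n : ℕ) (q : ℂˣ) : Uq n q →ₐ[ℂ] Uq n q ⊗[ℂ] Uq n q :=
  RingQuot.liftAlgHom ℂ ⟨FreeAlgebra.lift ℂ (comulGen n q), fun _ _ h => comul_rel h⟩

theorem comul_toUq (x : FreeAlgebra ℂ (Gen n)) :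
    comul n q (toUq n q x) = FreeAlgebra.lift ℂ (comulGen n q) x :=
  RingQuot.liftAlgHom_mkAlgHom_apply ℂ _ _ x

theorem comul_E (k : Fin (n - 1)) : comul n q (E k) = E k ⊗ₜ 1 + K k ⊗ₜ E k := by
  rw [E, comul_toUq, FreeAlgebra.lift_ι_apply]; rfl

theorem comul_F (k : Fin (n - 1)) : comul n q (F k) = F k ⊗ₜ Kinv k + 1 ⊗ₜ F k := by
  rw [F, comul_toUq, FreeAlgebra.lift_ι_apply]; rfl

theorem comul_L (i : Fin n) : comul n q (L i) = L i ⊗ₜ L i := by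
  rw [L, comul_toUq, FreeAlgebra.lift_ι_apply]; rfl

end Coproduct

/-! ### Tensor products of modules -/

section Tensor

/-- The action of `U_q ⊗ U_q` on `V ⊗ W`, factor by factor. -/
def tensorAct (n : ℕ) (q : ℂˣ) (V W : Type*) [AddCommGroup V] [Module ℂ V]
    [Module (Uq n q) V] [IsScalarTower ℂ (Uq n q) V] [AddCommGroup W] [Module ℂ W]
    [Module (Uq n q) W] [IsScalarTower ℂ (Uq n q) W] :
    Uq n q ⊗[ℂ] Uq n q →ₐ[ℂ] Module.End ℂ (V ⊗[ℂ] W) :=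
  Module.endTensorEndAlgHom.comp
    (Algebra.TensorProduct.map (Algebra.lsmul ℂ ℂ V) (Algebra.lsmul ℂ ℂ W))

/-- The vector space `V ⊗ W`, as a `U_q`-module through the coproduct. (A type of its own, since
Mathlib lets `U_q` act on `V ⊗[ℂ] W` through `V` alone.) -/
@[nolint unusedArguments]
def Tens (_n : ℕ) (_q : ℂˣ) (V W : Type*) [AddCommGroup V] [Module ℂ V] [AddCommGroup W]
    [Module ℂ W] : Type _ := V ⊗[ℂ] W

variable (n : ℕ) (q : ℂˣ) (V W : Type*) [AddCommGroup V] [Module ℂ V]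
  [Module (Uq n q) V] [IsScalarTower ℂ (Uq n q) V] [AddCommGroup W] [Module ℂ W]
  [Module (Uq n q) W] [IsScalarTower ℂ (Uq n q) W]

instance : AddCommGroup (Tens n q V W) := inferInstanceAs (AddCommGroup (V ⊗[ℂ] W))

instance : Module ℂ (Tens n q V W) := inferInstanceAs (Module ℂ (V ⊗[ℂ] W))

/-- The action of `U_q` on `V ⊗ W` through the coproduct. -/
def tensRep : Uq n q →ₐ[ℂ] Module.End ℂ (Tens n q V W) :=
  (tensorAct n q V W).comp (comul n q)

instance : Module (Uq n q) (Tens n q V W) := Module.compHom _ (tensRep n q V W).toRingHom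

theorem tens_smul (u : Uq n q) (x : Tens n q V W) : u • x = tensRep n q V W u x := rfl

instance : IsScalarTower ℂ (Uq n q) (Tens n q V W) where
  smul_assoc c u x := by rw [tens_smul, tens_smul, map_smul, LinearMap.smul_apply]

end Tensor

/-! ### Weights, the category `O`, Verma modules and their simple quotients -/

section CategoryO

variable (n : ℕ) (q : ℂˣ)

/-- The subalgebra `U_q⁺` generated by the `E_k`. -/
def Uplus : Subalgebra ℂ (Uq n q) := Algebra.adjoin ℂ (Set.range E)

/-- The part of degree `ν` of `U_q⁺`: it is spanned by the products of generators in which each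
`E_k` occurs `ν k` times. -/
def UplusDeg (ν : Fin (n - 1) → ℕ) : Submodule ℂ (Uq n q) :=
  Submodule.span ℂ {x | ∃ w : List (Fin (n - 1)), (∀ k, w.count k = ν k) ∧ x = (w.map E).prod}

/-- The part of degree `ν` of `U_q⁻`: it is spanned by the products of generators in which each
`F_k` occurs `ν k` times. -/
def UminusDeg (ν : Fin (n - 1) → ℕ) : Submodule ℂ (Uq n q) :=
  Submodule.span ℂ {x | ∃ w : List (Fin (n - 1)), (∀ k, w.count k = ν k) ∧ x = (w.map F).prod}

/-- The weight space `M_a`, on which each `L_i` acts by `q ^ (a | ε_i)`. -/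
def weightSpace (M : Type*) [AddCommGroup M] [Module ℂ M] [Module (Uq n q) M]
    [IsScalarTower ℂ (Uq n q) M] (a : Weight n) : Submodule ℂ M :=
  ⨅ i, LinearMap.ker (Algebra.lsmul ℂ ℂ M (L i : Uq n q) - (q : ℂ) ^ form a (eps i) • 1)

/-- Membership of a `U_q`-module in the category `O`. -/
structure InO (M : Type*) [AddCommGroup M] [Module ℂ M] [Module (Uq n q) M]
    [IsScalarTower ℂ (Uq n q) M] : Prop where
  /-- Each space `U_q⁺ v` is finite dimensional. -/
  finite_Uplus : ∀ v : M, FiniteDimensional ℂ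
    ((Subalgebra.toSubmodule (Uplus n q)).map
      ((LinearMap.toSpanSingleton (Uq n q) M v).restrictScalars ℂ))
  /-- The weight spaces are finite dimensional. -/
  finite_weightSpace : ∀ a, FiniteDimensional ℂ (weightSpace n q M a)
  /-- The module is the direct sum of its weight spaces. -/
  isInternal : DirectSum.IsInternal (weightSpace n q M)
  /-- The module is finitely generated. -/
  finite : Module.Finite (Uq n q) M

/-- The left ideal generated by the `E_k` and the `L_i - q ^ (a | ε_i)`. -/
def vermaIdeal (a : Weight n) : Submodule (Uq n q) (Uq n q) :=
  Submodule.span (Uq n q)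
    (Set.range E ∪ Set.range fun i => L i - algebraMap ℂ (Uq n q) ((q : ℂ) ^ form a (eps i)))

/-- The Verma module `M(a)`. -/
abbrev Verma (a : Weight n) : Type := Uq n q ⧸ vermaIdeal n q a

/-- The simple module `L(a)` of highest weight `a`: the quotient of the Verma module `M(a)` by the
sum of all its proper submodules. -/
abbrev Simple (a : Weight n) : Type :=
  Verma n q a ⧸ sSup {N : Submodule (Uq n q) (Verma n q a) | N ≠ ⊤}

end CategoryO

/-! ### The braiding attached to a family `P_ν` -/

section Braiding

variable (n : ℕ) (q : ℂˣ)

open Classical in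
/-- The projection of `M` to its weight space `M_a`, if `M` is the direct sum of its weight spaces
(and `0` otherwise). -/
def weightProj (M : Type*) [AddCommGroup M] [Module ℂ M] [Module (Uq n q) M]
    [IsScalarTower ℂ (Uq n q) M] (a : Weight n) : M →ₗ[ℂ] M :=
  if h : DirectSum.IsInternal (weightSpace n q M) then
    (weightSpace n q M a).subtype ∘ₗ DirectSum.component ℂ _ _ a ∘ₗ
      (LinearEquiv.ofBijective (DirectSum.coeLinearMap (weightSpace n q M)) h).symm.toLinearMap
  else 0

theorem weightProj_of_mem {M : Type*} [AddCommGroup M] [Module ℂ M] [Module (Uq n q) M]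
    [IsScalarTower ℂ (Uq n q) M] (h : DirectSum.IsInternal (weightSpace n q M)) {a : Weight n}
    (b : Weight n) {v : M} (hv : v ∈ weightSpace n q M a) :
    weightProj n q M b v = if a = b then v else 0 := by
  have key : (LinearEquiv.ofBijective (DirectSum.coeLinearMap (weightSpace n q M)) h).symm v =
      DirectSum.lof ℂ (Weight n) (fun a => weightSpace n q M a) a ⟨v, hv⟩ := by
    rw [LinearEquiv.symm_apply_eq]
    exact (DirectSum.coeLinearMap_lof (weightSpace n q M) a ⟨v, hv⟩).symm
  have h1 : weightProj n q M b v = (DirectSum.component ℂ (Weight n)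
      (fun a => weightSpace n q M a) b
      (DirectSum.lof ℂ (Weight n) (fun a => weightSpace n q M a) a ⟨v, hv⟩) : M) := by
    rw [weightProj, dif_pos h, ← key]
    rfl
  rw [h1]
  split_ifs with hab
  · subst hab
    rw [DirectSum.component.lof_self]
  · rw [DirectSum.component.of, dif_neg hab, ZeroMemClass.coe_zero]

variable (V W : Type*) [AddCommGroup V] [Module ℂ V] [Module (Uq n q) V]
  [IsScalarTower ℂ (Uq n q) V] [AddCommGroup W] [Module ℂ W] [Module (Uq n q) W]
  [IsScalarTower ℂ (Uq n q) W]

/-- The map `V ⊗ W → W ⊗ V`, `v ⊗ w ↦ q ^ (a | b) w ⊗ v` for `v ∈ V_a` and `w ∈ W_b`. It is the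
inverse of the map `W ⊗ V → V ⊗ W`, `w ⊗ v ↦ q ^ (-(a | b)) v ⊗ w`. -/
def PiInv (x : V ⊗[ℂ] W) : W ⊗[ℂ] V :=
  ∑ᶠ p : Weight n × Weight n, (q : ℂ) ^ form p.1 p.2 •
    TensorProduct.comm ℂ V W (TensorProduct.map (weightProj n q V p.1) (weightProj n q W p.2) x)

theorem PiInv_tmul (hV : DirectSum.IsInternal (weightSpace n q V))
    (hW : DirectSum.IsInternal (weightSpace n q W)) {a b : Weight n} {v : V} {w : W}
    (hv : v ∈ weightSpace n q V a) (hw : w ∈ weightSpace n q W b) :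
    PiInv n q V W (v ⊗ₜ w) = (q : ℂ) ^ form a b • (w ⊗ₜ[ℂ] v) := by
  rw [PiInv, finsum_eq_single _ (a, b)]
  · rw [TensorProduct.map_tmul, weightProj_of_mem n q hV a hv, weightProj_of_mem n q hW b hw,
      if_pos rfl, if_pos rfl, TensorProduct.comm_tmul]
  · rintro ⟨c, d⟩ h
    rw [TensorProduct.map_tmul, weightProj_of_mem n q hV c hv, weightProj_of_mem n q hW d hw]
    by_cases h1 : a = c
    · have h2 : b ≠ d := fun h2 => h (by rw [h1, h2])
      rw [if_neg h2, TensorProduct.tmul_zero, map_zero, smul_zero]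
    · rw [if_neg h1, TensorProduct.zero_tmul, map_zero, smul_zero]

/-- The map `R_{VW} : V ⊗ W → W ⊗ V`, `x ↦ Π⁻¹ (∑_ν P_ν x)`, attached to a family `P_ν` of
elements of `U_q ⊗ U_q`. (For `V`, `W` in `O` and `P_ν ∈ U_ν⁻ ⊗ U_ν⁺`, only finitely many terms of
the sum are nonzero for a given `x`.) -/
def braiding (P : (Fin (n - 1) → ℕ) → Uq n q ⊗[ℂ] Uq n q) : Tens n q V W → Tens n q W V :=
  fun x => PiInv n q V W (∑ᶠ ν, tensorAct n q V W (P ν) x)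

/-- The property that determines the universal `R`-matrix: `P_ν ∈ U_ν⁻ ⊗ U_ν⁺`, `P_0 = 1 ⊗ 1`, and
`R_{VW}` is an isomorphism of `U_q`-modules for all `V`, `W` in `O`. -/
structure IsRMatrixFamily (P : (Fin (n - 1) → ℕ) → Uq n q ⊗[ℂ] Uq n q) : Prop where
  mem : ∀ ν, P ν ∈ Submodule.map₂ (TensorProduct.mk ℂ (Uq n q) (Uq n q))
    (UminusDeg n q ν) (UplusDeg n q ν)
  zero : P 0 = 1
  iso : ∀ (V W : Type) [AddCommGroup V] [Module ℂ V] [Module (Uq n q) V]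
    [IsScalarTower ℂ (Uq n q) V] [AddCommGroup W] [Module ℂ W] [Module (Uq n q) W]
    [IsScalarTower ℂ (Uq n q) W], InO n q V → InO n q W →
    ∃ e : Tens n q V W ≃ₗ[Uq n q] Tens n q W V, ⇑e = braiding n q V W P

end Braiding

/-! ### The universal `R`-matrix of `U_q(gl_n)`, in closed form -/

section RMatrix

variable (n : ℕ) (q : ℂˣ)

/-- The generator `E_k`, for a natural number `k` (and `0` if `k` is out of range). -/
def natE (k : ℕ) : Uq n q := if h : k < n - 1 then E ⟨k, h⟩ else 0

/-- The generator `F_k`, for a natural number `k` (and `0` if `k` is out of range). -/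
def natF (k : ℕ) : Uq n q := if h : k < n - 1 then F ⟨k, h⟩ else 0

/-- The root vector of weight `ε_i - ε_{i+d+1}`:
`E_{i,i+1} = E_i` and `E_{i,j+1} = E_{i,j} E_j - q⁻¹ E_j E_{i,j}`. -/
def rootE (i : ℕ) : ℕ → Uq n q
  | 0 => natE n q i
  | d + 1 => rootE i d * natE n q (i + d + 1) -
      (q : ℂ)⁻¹ • (natE n q (i + d + 1) * rootE i d)

/-- The root vector of weight `-(ε_i - ε_{i+d+1})`:
`F_{i,i+1} = F_i` and `F_{i,j+1} = F_j F_{i,j} - q F_{i,j} F_j`. -/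
def rootF (i : ℕ) : ℕ → Uq n q
  | 0 => natF n q i
  | d + 1 => natF n q (i + d + 1) * rootF i d -
      (q : ℂ) • (rootF i d * natF n q (i + d + 1))

/-- The pairs `i < j`, for the positive roots `ε_i - ε_j`, in lexicographic order. -/
def posRoots : List (Fin n × Fin n) :=
  (List.finRange n ×ˢ List.finRange n).filter fun p => p.1 < p.2

/-- The degree `∑ m_{ij} (ε_i - ε_j)` in terms of the simple roots: `ε_k - ε_{k+1}` occurs in
`ε_i - ε_j` if and only if `i ≤ k < j`. -/
def rootDeg (m : Fin n × Fin n → ℕ) (k : Fin (n - 1)) : ℕ :=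
  ∑ p : Fin n × Fin n, if (p.1 : ℕ) ≤ k ∧ (k : ℕ) < p.2 then m p else 0

/-- The coefficient `q ^ (m (m - 1) / 2) (q - q⁻¹) ^ m / [m]!`, where
`[m]! = ∏_{k = 1}^m (q ^ k - q ^ (-k)) / (q - q⁻¹)`. -/
def expCoeff (m : ℕ) : ℂ :=
  (q : ℂ) ^ m.choose 2 * ((q : ℂ) - (q : ℂ)⁻¹) ^ m /
    ∏ k ∈ Finset.range m,
      (((q : ℂ) ^ (k + 1) - (q : ℂ)⁻¹ ^ (k + 1)) / ((q : ℂ) - (q : ℂ)⁻¹))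

/-- The universal `R`-matrix: the terms `P_ν`, of degree `ν`, of the product over the positive roots
`ε_i - ε_j`, in lexicographic order, of the `q`-exponentials `∑_m c_m F_{ij}^m ⊗ E_{ij}^m`, with
`c_m` as in `expCoeff`. -/
def universalR (ν : Fin (n - 1) → ℕ) : Uq n q ⊗[ℂ] Uq n q :=
  ∑ᶠ (m : Fin n × Fin n → ℕ) (_ : (∀ p, ¬ p.1 < p.2 → m p = 0) ∧ rootDeg n m = ν),
    ((posRoots n).map fun p => expCoeff q (m p) •
      ((rootF n q p.1 ((p.2 : ℕ) - p.1 - 1) ^ m p) ⊗ₜ[ℂ]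
        (rootE n q p.1 ((p.2 : ℕ) - p.1 - 1) ^ m p))).prod

end RMatrix

end QuantumGL

end

noncomputable section

namespace QuantumGL

set_option linter.unusedSectionVars false

/-! ### Highest weight modules and weight vectors -/

section Modules

variable {n : ℕ} {q : ℂˣ}

/-! Everything reduces to one explicit operator. The module `L(ε_1)` is the natural module, with
basis `v_0, …, v_{n-1}` on which `E_k` and `F_k` act as matrix units (`exists_isNatural`). On its
tensor square, `rMap` sends `v_i ⊗ v_j` to `q ^ δ_{ij} v_j ⊗ v_i`, plus `(q - q⁻¹) v_i ⊗ v_j` when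
`i < j`. A check on basis vectors shows that it commutes with `U_q` (`IsNatural.rMap_smul`) and
satisfies the Hecke relation `R² = (q - q⁻¹) R + 1` (`rMap_rMap`). This yields invertibility and the
quadratic equation.

The closed formula gives this operator (`IsNatural.braiding_universalR`): `F_{ij} ⊗ E_{ij}` maps
`v_i ⊗ v_j` to `v_j ⊗ v_i` and kills the other basis vectors, so for positive roots the product of
any two such operators is zero. Only the constant term and the linear terms of the product of
`q`-exponentials survive.

Any R-matrix family gives it too (`IsNatural.braiding_eq`). Terms of nonzero degree kill `v_i ⊗
v_0`, since every `E_k` kills `v_0`; there the braiding is just `Π⁻¹`, which agrees with `rMap`.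
Both maps are `U_q`-linear, and the vectors `v_i ⊗ v_0` generate `V ⊗ V`.

The submodules `A` and `B` are the eigenspaces of `rMap`, complementary because `q + q⁻¹ ≠ 0`. They
are treated together: both `t = q` and `t = -q⁻¹` satisfy `t - t⁻¹ = q - q⁻¹`, and then `R + t⁻¹`
maps onto the `t`-eigenspace. The images `ee` of the basis vectors span it, those of equal weight
are proportional, and the generators connect the nonzero ones; hence the eigenspace is simple
(`isSimpleModule_eigen`). A simple module with a highest weight vector is the corresponding `L(a)`
(`nonempty_equiv_simple`). -/

theorem form_eps (a : Weight n) (i : Fin n) : form a (eps i) = a i := by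
  simp [form, eps, Pi.single_apply]

/-- Induction on the generators of `U_q`. -/
theorem Uq_induction {p : Uq n q → Prop} (hE : ∀ k, p (E k)) (hF : ∀ k, p (F k))
    (hL : ∀ i, p (L i)) (hLinv : ∀ i, p (Linv i)) (hc : ∀ c : ℂ, p (algebraMap ℂ _ c))
    (hmul : ∀ x y, p x → p y → p (x * y)) (hadd : ∀ x y, p x → p y → p (x + y))
    (u : Uq n q) : p u := by
  obtain ⟨x, rfl⟩ : ∃ x, toUq n q x = u := RingQuot.mkAlgHom_surjective ℂ (Rel n q) u
  induction x using FreeAlgebra.induction with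
  | grade0 c => rw [AlgHom.commutes]; exact hc c
  | grade1 g =>
    cases g with
    | E k => exact hE k
    | F k => exact hF k
    | L i => exact hL i
    | Linv i => exact hLinv i
  | mul a b ha hb => rw [map_mul]; exact hmul _ _ ha hb
  | add a b ha hb => rw [map_add]; exact hadd _ _ ha hb

variable {M : Type*} [AddCommGroup M] [Module ℂ M] [Module (Uq n q) M]
  [IsScalarTower ℂ (Uq n q) M]

/-- A subspace stable under the generators is stable under `U_q`. -/
theorem smul_mem_of_generators {S : Submodule ℂ M} (hE : ∀ k, ∀ x ∈ S, (E k : Uq n q) • x ∈ S)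
    (hF : ∀ k, ∀ x ∈ S, (F k : Uq n q) • x ∈ S) (hL : ∀ i, ∀ x ∈ S, (L i : Uq n q) • x ∈ S)
    (hLinv : ∀ i, ∀ x ∈ S, (Linv i : Uq n q) • x ∈ S) (u : Uq n q) : ∀ x ∈ S, u • x ∈ S := by
  induction u using Uq_induction with
  | hE k => exact hE k
  | hF k => exact hF k
  | hL i => exact hL i
  | hLinv i => exact hLinv i
  | hc c => intro x hx; rw [algebraMap_smul]; exact S.smul_mem c hx
  | hmul a b ha hb => intro x hx; rw [mul_smul]; exact ha _ (hb _ hx)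
  | hadd a b ha hb => intro x hx; rw [add_smul]; exact S.add_mem (ha _ hx) (hb _ hx)

/-- A linear map that commutes with the `E_k`, `F_k`, `L_i` commutes with `U_q`. -/
theorem map_smul_of_generators {N : Type*} [AddCommGroup N] [Module ℂ N] [Module (Uq n q) N]
    [IsScalarTower ℂ (Uq n q) N] (f : M →ₗ[ℂ] N)
    (hE : ∀ k x, f ((E k : Uq n q) • x) = (E k : Uq n q) • f x)
    (hF : ∀ k x, f ((F k : Uq n q) • x) = (F k : Uq n q) • f x)
    (hL : ∀ i x, f ((L i : Uq n q) • x) = (L i : Uq n q) • f x) (u : Uq n q) :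
    ∀ x, f (u • x) = u • f x := by
  induction u using Uq_induction with
  | hE k => exact hE k
  | hF k => exact hF k
  | hL i => exact hL i
  | hLinv i =>
    intro x
    have h := hL i ((Linv i : Uq n q) • x)
    rw [smul_smul, L_mul_Linv, one_smul] at h
    rw [h, smul_smul, Linv_mul_L, one_smul]
  | hc c => intro x; rw [algebraMap_smul, algebraMap_smul, map_smul]
  | hmul a b ha hb => intro x; rw [mul_smul, mul_smul, ha, hb]
  | hadd a b ha hb => intro x; rw [add_smul, add_smul, map_add, ha, hb]

variable (q) in
/-- The vector `x` has weight `a`. -/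
def IsWt (a : Weight n) (x : M) : Prop := ∀ i, (L i : Uq n q) • x = (q : ℂ) ^ a i • x

theorem mem_weightSpace {a : Weight n} {x : M} : x ∈ weightSpace n q M a ↔ IsWt q a x := by
  simp [weightSpace, IsWt, Submodule.mem_iInf, form_eps, sub_eq_zero]

theorem IsWt.Linv_smul {a : Weight n} {x : M} (h : IsWt q a x) (i : Fin n) :
    (Linv i : Uq n q) • x = (q : ℂ) ^ (-a i) • x := by
  have h1 := congrArg (fun y => (Linv i : Uq n q) • y) (h i)
  simp only [smul_smul, Linv_mul_L, one_smul] at h1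
  rw [smul_comm] at h1
  conv_rhs => rw [h1, smul_smul, ← zpow_add₀ q.ne_zero, neg_add_cancel, zpow_zero, one_smul]

theorem IsWt.K_smul {a : Weight n} {x : M} (h : IsWt q a x) (k : Fin (n - 1)) :
    (K k : Uq n q) • x = (q : ℂ) ^ (a (lo k) - a (hi k)) • x := by
  rw [K, mul_smul, h.Linv_smul, smul_comm, h, smul_smul, ← zpow_add₀ q.ne_zero]
  congr 2; ring

theorem IsWt.Kinv_smul {a : Weight n} {x : M} (h : IsWt q a x) (k : Fin (n - 1)) :
    (Kinv k : Uq n q) • x = (q : ℂ) ^ (a (hi k) - a (lo k)) • x := by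
  rw [Kinv, mul_smul, h.Linv_smul, smul_comm, h, smul_smul, ← zpow_add₀ q.ne_zero]
  congr 2; ring

theorem IsWt.F_smul {a : Weight n} {x : M} (h : IsWt q a x) (k : Fin (n - 1)) :
    IsWt q (a - simpleRoot k) ((F k : Uq n q) • x) := by
  intro i
  rw [smul_smul, L_F, smul_assoc, mul_smul, h, smul_comm _ ((q : ℂ) ^ a i), smul_smul,
    ← zpow_add₀ q.ne_zero, form_eps]
  congr 2
  rw [Pi.sub_apply]; ring

/-- The pairing of a weight with `∑ (n - i) ε_i`; it takes the value `1` on each simple root. -/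
def height (a : Weight n) : ℤ := ∑ i : Fin n, ((n - (i : ℕ) : ℕ) : ℤ) * a i

theorem height_simpleRoot (k : Fin (n - 1)) : height (simpleRoot k) = 1 := by
  have := k.2
  simp only [height, simpleRoot, eps, Pi.sub_apply, Pi.single_apply, mul_sub, mul_ite, mul_one,
    mul_zero, Finset.sum_sub_distrib, Finset.sum_ite_eq', Finset.mem_univ, if_true, lo, hi]
  omega

theorem height_sub (a b : Weight n) : height (a - b) = height a - height b := by
  simp [height, mul_sub, Finset.sum_sub_distrib]

variable (n q) in
/-- An element that acts on each vector of weight `a` by `q ^ height a`. -/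
def heightElt : Uq n q := ((List.finRange n).map fun i => L i ^ (n - (i : ℕ))).prod

theorem IsWt.heightElt_smul {a : Weight n} {x : M} (h : IsWt q a x) :
    heightElt n q • x = (q : ℂ) ^ height a • x := by
  have hpow : ∀ (i : Fin n) (m : ℕ), (L i ^ m : Uq n q) • x = (q : ℂ) ^ ((m : ℤ) * a i) • x := by
    intro i m
    induction m with
    | zero => simp
    | succ m ih =>
      rw [pow_succ, mul_smul, h, smul_comm, ih, smul_smul, ← zpow_add₀ q.ne_zero]
      congr 2; push_cast; ring
  have key : ∀ l : List (Fin n), (l.map fun i => (L i ^ (n - (i : ℕ)) : Uq n q)).prod • x =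
      (q : ℂ) ^ (l.map fun i : Fin n => ((n - (i : ℕ) : ℕ) : ℤ) * a i).sum • x := by
    intro l
    induction l with
    | nil => simp
    | cons i l ih =>
      rw [List.map_cons, List.prod_cons, mul_smul, ih, smul_comm, hpow, smul_smul,
        ← zpow_add₀ q.ne_zero, List.map_cons, List.sum_cons, add_comm]
  rw [heightElt, key, height, ← List.ofFn_eq_map, List.sum_ofFn]

variable (n q) in
/-- An element that kills the vectors whose height lies in `[h - N, h - 1]`. -/
def heightCut (h : ℤ) : ℕ → Uq n q
  | 0 => 1
  | N + 1 => heightCut h N * (heightElt n q - algebraMap ℂ _ ((q : ℂ) ^ (h - N - 1)))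

theorem IsWt.heightCut_smul {a : Weight n} {x : M} (ha : IsWt q a x) (h : ℤ) (N : ℕ) :
    heightCut n q h N • x =
      (∏ r ∈ Finset.range N, ((q : ℂ) ^ height a - (q : ℂ) ^ (h - r - 1))) • x := by
  induction N with
  | zero => simp [heightCut]
  | succ N ih =>
    rw [heightCut, mul_smul, sub_smul, ha.heightElt_smul, algebraMap_smul, ← sub_smul, smul_comm,
      ih, smul_smul, Finset.prod_range_succ, mul_comm]

theorem zpow_inj (hq : ¬ IsOfFinOrder q) {a b : ℤ} (h : (q : ℂ) ^ a = (q : ℂ) ^ b) : a = b := by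
  apply injective_zpow_iff_not_isOfFinOrder.mpr hq
  apply Units.ext
  simpa using h

theorem isWt_word {a : Weight n} {m : M} (ha : IsWt q a m) (w : List (Fin (n - 1))) :
    ∃ b : Weight n, IsWt q b (((w.map F).prod : Uq n q) • m) ∧ height b = height a - w.length := by
  induction w with
  | nil => exact ⟨a, by simpa using ha, by simp⟩
  | cons k w ih =>
    obtain ⟨b, hb, hh⟩ := ih
    refine ⟨b - simpleRoot k, ?_, ?_⟩
    · rw [List.map_cons, List.prod_cons, mul_smul]; exact hb.F_smul k
    · rw [height_sub, height_simpleRoot, hh, List.length_cons]; push_cast; ring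

/-- A module generated by a highest weight vector `m` is spanned by the products of the `F_k`
applied to `m`. -/
theorem span_word_eq_top {a : Weight n} {m : M} (ha : IsWt q a m)
    (hE : ∀ k, (E k : Uq n q) • m = 0) (htop : Submodule.span (Uq n q) {m} = ⊤) :
    Submodule.span ℂ (Set.range fun w : List (Fin (n - 1)) => ((w.map F).prod : Uq n q) • m)
      = ⊤ := by
  set S := Submodule.span ℂ
    (Set.range fun w : List (Fin (n - 1)) => ((w.map F).prod : Uq n q) • m) with hS
  have hw : ∀ w : List (Fin (n - 1)), ((w.map F).prod : Uq n q) • m ∈ S := fun w =>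
    Submodule.subset_span ⟨w, rfl⟩
  have lift : ∀ u : Uq n q, (∀ w : List (Fin (n - 1)), u • ((w.map F).prod : Uq n q) • m ∈ S) →
      ∀ x ∈ S, u • x ∈ S := by
    intro u hu x hx
    induction hx using Submodule.span_induction with
    | mem x hx => obtain ⟨w, rfl⟩ := hx; exact hu w
    | zero => rw [smul_zero]; exact S.zero_mem
    | add x y _ _ hx hy => rw [smul_add]; exact S.add_mem hx hy
    | smul c x _ hx => rw [smul_comm]; exact S.smul_mem c hx
  have sF : ∀ k, ∀ x ∈ S, (F k : Uq n q) • x ∈ S := fun k => lift _ fun w => by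
    have := hw (k :: w)
    rwa [List.map_cons, List.prod_cons, mul_smul] at this
  -- Moving `E_k` past the first letter leaves `E_k` on a shorter word and, if that letter is `F_k`,
  -- a term in `K_k - K_k⁻¹`, which is a scalar on the weight vector that remains.
  have sE : ∀ k (w : List (Fin (n - 1))), (E k : Uq n q) • ((w.map F).prod : Uq n q) • m ∈ S := by
    intro k w
    induction w with
    | nil => simp [hE]
    | cons j w ih =>
      rw [List.map_cons, List.prod_cons, smul_smul, ← mul_assoc]
      obtain ⟨b, hb, -⟩ := isWt_word ha w
      by_cases hjk : k = j
      · subst hjk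
        rw [E_F_eq, add_mul, add_smul, mul_assoc, mul_smul, mul_smul, smul_mul_assoc, smul_assoc,
          mul_smul, sub_smul, hb.K_smul, hb.Kinv_smul]
        exact S.add_mem (sF _ _ ih) (S.smul_mem _ (S.sub_mem (S.smul_mem _ (hw w))
          (S.smul_mem _ (hw w))))
      · rw [E_F_ne hjk, mul_assoc, mul_smul, mul_smul]
        exact sF _ _ ih
  have stable : ∀ u : Uq n q, ∀ x ∈ S, u • x ∈ S := smul_mem_of_generators
    (fun k => lift _ (sE k)) sF
    (fun i => lift _ fun w => by
      obtain ⟨b, hb, -⟩ := isWt_word ha w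
      rw [hb]; exact S.smul_mem _ (hw w))
    (fun i => lift _ fun w => by
      obtain ⟨b, hb, -⟩ := isWt_word ha w
      rw [hb.Linv_smul]; exact S.smul_mem _ (hw w))
  rw [eq_top_iff]
  intro x _
  have hx : x ∈ Submodule.span (Uq n q) {m} := htop ▸ Submodule.mem_top
  obtain ⟨u, rfl⟩ := Submodule.mem_span_singleton.1 hx
  exact stable u m (by simpa using hw [])

/-- In a module generated by a highest weight vector `m`, the elements `heightCut` map each vector
to a multiple of `m`. -/
theorem exists_heightCut_smul {a : Weight n} {m : M} (ha : IsWt q a m)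
    (hE : ∀ k, (E k : Uq n q) • m = 0) (htop : Submodule.span (Uq n q) {m} = ⊤) (x : M) :
    ∃ (c : ℂ) (N : ℕ), ∀ r ≥ N, heightCut n q (height a) r • x =
      c • heightCut n q (height a) r • m := by
  have hx : x ∈ Submodule.span ℂ
      (Set.range fun w : List (Fin (n - 1)) => ((w.map F).prod : Uq n q) • m) := by
    rw [span_word_eq_top ha hE htop]; trivial
  induction hx using Submodule.span_induction with
  | mem x hx =>
    obtain ⟨w, rfl⟩ := hx
    cases w with
    | nil => exact ⟨1, 0, fun r _ => by simp⟩
    | cons k w =>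
      -- A nonempty word lowers the height by its length `w.length + 1`, so the factor with index
      -- `w.length` vanishes on it.
      refine ⟨0, w.length + 1, fun r hr => ?_⟩
      obtain ⟨b, hb, hh⟩ := isWt_word ha (k :: w)
      dsimp only
      rw [hb.heightCut_smul, zero_smul, Finset.prod_eq_zero (i := w.length), zero_smul]
      · exact Finset.mem_range.2 hr
      · rw [hh, List.length_cons, sub_eq_zero]
        congr 1; push_cast; ring
  | zero => exact ⟨0, 0, fun r _ => by simp⟩
  | add x y _ _ hx hy =>
    obtain ⟨c, N, h⟩ := hx
    obtain ⟨d, N', h'⟩ := hy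
    refine ⟨c + d, max N N', fun r hr => ?_⟩
    rw [smul_add, h r (le_trans (le_max_left _ _) hr), h' r (le_trans (le_max_right _ _) hr),
      add_smul]
  | smul d x _ hx =>
    obtain ⟨c, N, h⟩ := hx
    refine ⟨d * c, N, fun r hr => ?_⟩
    rw [smul_comm, h r hr, smul_smul]

/-- A simple module with a highest weight vector of weight `a` is isomorphic to `L(a)`. -/
theorem nonempty_equiv_simple (hq : ¬ IsOfFinOrder q) [IsSimpleModule (Uq n q) M] {a : Weight n}
    {m : M} (ha : IsWt q a m) (hE : ∀ k, (E k : Uq n q) • m = 0) (hm : m ≠ 0) :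
    Nonempty (M ≃ₗ[Uq n q] Simple n q a) := by
  have hle : vermaIdeal n q a ≤ LinearMap.ker (LinearMap.toSpanSingleton (Uq n q) M m) := by
    rw [vermaIdeal, Submodule.span_le]
    rintro _ (⟨k, rfl⟩ | ⟨i, rfl⟩)
    · simpa using hE k
    · simp only [SetLike.mem_coe, LinearMap.mem_ker, LinearMap.toSpanSingleton_apply, sub_smul,
        algebraMap_smul, form_eps, ha i, sub_self]
  let φ : Verma n q a →ₗ[Uq n q] M := (vermaIdeal n q a).liftQ _ hle
  let v : Verma n q a := Submodule.Quotient.mk 1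
  have hφv : φ v = m := by
    change (LinearMap.toSpanSingleton (Uq n q) M m) 1 = m
    simp
  have hsurj : Function.Surjective φ := by
    rw [← LinearMap.range_eq_top]
    refine (eq_bot_or_eq_top _).resolve_left fun h => hm ?_
    have : φ v ∈ LinearMap.range φ := ⟨v, rfl⟩
    rw [h, hφv] at this
    simpa using this
  have hmk : ∀ u : Uq n q, (Submodule.Quotient.mk u : Verma n q a) = u • v := fun u => by
    rw [← Submodule.Quotient.mk_smul, smul_eq_mul, mul_one]
  have hvE : ∀ k, (E k : Uq n q) • v = 0 := fun k => by
    rw [← hmk, Submodule.Quotient.mk_eq_zero]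
    exact Submodule.subset_span (Or.inl ⟨k, rfl⟩)
  have hva : IsWt q a v := fun i => by
    rw [← sub_eq_zero, ← algebraMap_smul (Uq n q) ((q : ℂ) ^ a i) v, ← sub_smul, ← hmk,
      Submodule.Quotient.mk_eq_zero]
    exact Submodule.subset_span (Or.inr ⟨i, by simp only [form_eps]⟩)
  have hvtop : ∀ N : Submodule (Uq n q) (Verma n q a), v ∈ N → N = ⊤ := by
    intro N hN
    rw [eq_top_iff]
    intro x _
    obtain ⟨u, rfl⟩ := Submodule.Quotient.mk_surjective _ x
    rw [hmk]
    exact N.smul_mem u hN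
  -- The scalar by which `heightCut` acts on the highest weight vector; its factors are nonzero
  -- because `q` has infinite order.
  have hκ : ∀ r : ℕ, ∏ s ∈ Finset.range r,
      ((q : ℂ) ^ height a - (q : ℂ) ^ (height a - s - 1)) ≠ 0 := by
    intro r
    rw [Finset.prod_ne_zero_iff]
    intro s _ h0
    have := zpow_inj hq (sub_eq_zero.1 h0)
    omega
  have hco : IsCoatom (LinearMap.ker φ) := LinearMap.isCoatom_ker_of_surjective hsurj
  have hker : sSup {N : Submodule (Uq n q) (Verma n q a) | N ≠ ⊤} = LinearMap.ker φ := by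
    refine le_antisymm (sSup_le fun N hN => ?_) (le_sSup hco.1)
    -- If `N` is not inside the maximal submodule `ker φ`, then `v = y + x` with `φ y = 0` and `x ∈
    -- N`. Cutting by height turns `x` into a multiple of `v`. A nonzero multiple puts `v` in `N`,
    -- so `N` is everything; a zero multiple, pushed through `φ`, forces `m = 0`.
    by_contra hNφ
    have hsup : LinearMap.ker φ ⊔ N = ⊤ := by
      refine hco.2 _ (lt_of_le_of_ne le_sup_left fun h => hNφ ?_)
      rw [h]; exact le_sup_right
    obtain ⟨y, hy, x, hx, hxy⟩ := Submodule.mem_sup.1 (hsup ▸ Submodule.mem_top : v ∈ _)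
    obtain ⟨c, r, hc⟩ := exists_heightCut_smul hva hvE (hvtop _ (Submodule.mem_span_singleton_self v)) x
    have h1 := hc r le_rfl
    rw [hva.heightCut_smul, smul_smul] at h1
    have h2 : φ x = m := by
      rw [← hφv, ← hxy, map_add, LinearMap.mem_ker.1 hy, zero_add]
    by_cases hc0 : c = 0
    · have h3 := congrArg φ h1
      rw [hc0, zero_mul, zero_smul, map_zero, map_smul, h2, ha.heightCut_smul] at h3
      exact hm ((smul_eq_zero.1 h3).resolve_left (hκ r))
    · have h3 : (c * _) • v ∈ N := h1 ▸ N.smul_mem (heightCut n q (height a) r) hx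
      refine hN (hvtop N ?_)
      have h4 := N.smul_mem (algebraMap ℂ (Uq n q)
        (c * ∏ s ∈ Finset.range r, ((q : ℂ) ^ height a - (q : ℂ) ^ (height a - s - 1)))⁻¹) h3
      rwa [algebraMap_smul, smul_smul, inv_mul_cancel₀ (mul_ne_zero hc0 (hκ r)), one_smul] at h4
  exact ⟨((Submodule.quotEquivOfEq _ _ hker).trans (φ.quotKerEquivOfSurjective hsurj)).symm⟩

/-- A nonzero submodule of a module with a finite basis of weight vectors contains a nonzero weight
vector, whose coordinates vanish at the basis vectors of other weights. -/
theorem exists_weight_vector (hq : ¬ IsOfFinOrder q) {ι : Type*} [Finite ι] (b : Module.Basis ι ℂ M)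
    {wt : ι → Weight n} (hb : ∀ i, IsWt q (wt i) (b i)) {N : Submodule (Uq n q) M} (hN : N ≠ ⊥) :
    ∃ x ∈ N, ∃ i, b.repr x i ≠ 0 ∧ ∀ j, b.repr x j ≠ 0 → wt j = wt i := by
  classical
  obtain ⟨y, hy, hy0⟩ := Submodule.exists_mem_ne_zero_of_ne_bot hN
  have hrepr : ∀ (l : Fin n) (x : M) (i : ι),
      b.repr ((L l : Uq n q) • x) i = (q : ℂ) ^ wt i l * b.repr x i := by
    intro l x i
    have : (Finsupp.lapply i ∘ₗ b.repr.toLinearMap) ∘ₗ (Algebra.lsmul ℂ ℂ M (L l : Uq n q)) =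
        (q : ℂ) ^ wt i l • (Finsupp.lapply i ∘ₗ b.repr.toLinearMap) := by
      refine b.ext fun j => ?_
      simp only [LinearMap.comp_apply, Algebra.lsmul_coe, LinearMap.smul_apply, hb j l, map_smul,
        LinearEquiv.coe_coe, Module.Basis.repr_self, Finsupp.lapply_apply, smul_eq_mul,
        Finsupp.single_apply]
      split_ifs with h
      · rw [h]
      · simp
    exact LinearMap.congr_fun this x
  -- Descent on the number of nonzero coordinates: two different weights in `y` are separated by
  -- some `L_l`.
  induction hs : (b.repr y).support.card using Nat.strong_induction_on generalizing y with
  | _ s ih =>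
  obtain ⟨i, hi⟩ : ∃ i, b.repr y i ≠ 0 := by
    by_contra! h
    exact hy0 (b.repr.map_eq_zero_iff.1 (Finsupp.ext h))
  by_cases hall : ∀ j, b.repr y j ≠ 0 → wt j = wt i
  · exact ⟨y, hy, i, hi, hall⟩
  push Not at hall
  obtain ⟨j, hj, hji⟩ := hall
  obtain ⟨l, hl⟩ := Function.ne_iff.1 hji
  -- Passing to `z` removes the coordinate `i`, keeps the coordinate `j` nonzero and creates no new
  -- ones.
  set z := (L l : Uq n q) • y - (q : ℂ) ^ wt i l • y with hz
  have hzr : ∀ k, b.repr z k = ((q : ℂ) ^ wt k l - (q : ℂ) ^ wt i l) * b.repr y k := by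
    intro k
    rw [hz, map_sub, Finsupp.sub_apply, hrepr, map_smul, Finsupp.smul_apply, smul_eq_mul, sub_mul]
  refine ih _ ?_ z ?_ ?_ rfl
  · rw [← hs]
    refine Finset.card_lt_card ⟨fun k hk => ?_, fun h => ?_⟩
    · rw [Finsupp.mem_support_iff, hzr] at hk
      exact Finsupp.mem_support_iff.2 (right_ne_zero_of_mul hk)
    · have := Finsupp.mem_support_iff.1 (h (Finsupp.mem_support_iff.2 hi))
      rw [hzr, sub_self, zero_mul] at this
      exact this rfl
  · rw [hz, ← algebraMap_smul (Uq n q) ((q : ℂ) ^ wt i l) y]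
    exact N.sub_mem (N.smul_mem _ hy) (N.smul_mem _ hy)
  · intro h0
    have := hzr j
    rw [h0, map_zero, Finsupp.zero_apply, eq_comm, mul_eq_zero, sub_eq_zero] at this
    exact this.elim (fun h => hl (zpow_inj hq h)) hj

end Modules

/-! ### The natural module and its identification with `L(ε_1)` -/

section Natural

variable {n : ℕ} {q : ℂˣ}

theorem sub_inv_ne_zero (hq : ¬ IsOfFinOrder q) : (q : ℂ) - (q : ℂ)⁻¹ ≠ 0 := by
  intro h
  have : (q : ℂ) ^ (1 : ℤ) = (q : ℂ) ^ (-1 : ℤ) := by simpa [sub_eq_zero] using h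
  exact absurd (zpow_inj hq this) (by norm_num)

/-- Otherwise `q² = -1`, hence `q⁴ = 1`. This is what keeps the eigenvalues `q` and `-q⁻¹` distinct.
-/
theorem add_inv_ne_zero (hq : ¬ IsOfFinOrder q) : (q : ℂ) + (q : ℂ)⁻¹ ≠ 0 := by
  intro h
  have h2 : (q : ℂ) ^ 2 = -1 := by
    have := congrArg (· * (q : ℂ)) h
    simp only [add_mul, inv_mul_cancel₀ q.ne_zero, zero_mul] at this
    linear_combination this
  have : (q : ℂ) ^ (4 : ℤ) = (q : ℂ) ^ (0 : ℤ) := by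
    rw [zpow_zero, zpow_ofNat]
    linear_combination ((q : ℂ) ^ 2 - 1) * h2
  exact absurd (zpow_inj hq this) (by norm_num)

/-- The values of the natural representation on the generators. -/
def natGen (n : ℕ) (q : ℂˣ) : Gen n → Module.End ℂ (Fin n → ℂ)
  | .E k => LinearMap.pi fun l => if l = lo k then LinearMap.proj (hi k) else 0
  | .F k => LinearMap.pi fun l => if l = hi k then LinearMap.proj (lo k) else 0
  | .L i => LinearMap.pi fun l => (if l = i then (q : ℂ) else 1) • LinearMap.proj l
  | .Linv i => LinearMap.pi fun l => (if l = i then (q : ℂ)⁻¹ else 1) • LinearMap.proj l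

theorem natGen_E (k : Fin (n - 1)) (f : Fin n → ℂ) (l : Fin n) :
    natGen n q (.E k) f l = if l = lo k then f (hi k) else 0 := by
  rw [natGen, LinearMap.pi_apply]; split_ifs <;> rfl

theorem natGen_F (k : Fin (n - 1)) (f : Fin n → ℂ) (l : Fin n) :
    natGen n q (.F k) f l = if l = hi k then f (lo k) else 0 := by
  rw [natGen, LinearMap.pi_apply]; split_ifs <;> rfl

theorem natGen_L (i : Fin n) (f : Fin n → ℂ) (l : Fin n) :
    natGen n q (.L i) f l = (if l = i then (q : ℂ) else 1) * f l := rfl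

theorem natGen_Linv (i : Fin n) (f : Fin n → ℂ) (l : Fin n) :
    natGen n q (.Linv i) f l = (if l = i then (q : ℂ)⁻¹ else 1) * f l := rfl

theorem lo_ne_hi (k : Fin (n - 1)) : lo k ≠ hi k := by simp [lo, hi]

theorem lo_inj {j k : Fin (n - 1)} : lo j = lo k ↔ j = k := by simp [lo, Fin.ext_iff]

theorem hi_inj {j k : Fin (n - 1)} : hi j = hi k ↔ j = k := by simp [hi, Fin.ext_iff]

theorem natGen_rel (hq : ¬ IsOfFinOrder q) {x y : FreeAlgebra ℂ (Gen n)} (h : Rel n q x y) :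
    FreeAlgebra.lift ℂ (natGen n q) x = FreeAlgebra.lift ℂ (natGen n q) y := by
  have h0 := q.ne_zero
  have h1 := sub_inv_ne_zero hq
  refine LinearMap.ext fun f => funext fun l => ?_
  induction h with
  | L_Linv i =>
    simp only [map_mul, FreeAlgebra.lift_ι_apply, Module.End.mul_apply, natGen_L, natGen_Linv,
      map_one, Module.End.one_apply]
    split_ifs <;> simp
  | Linv_L i =>
    simp only [map_mul, FreeAlgebra.lift_ι_apply, Module.End.mul_apply, natGen_L, natGen_Linv,
      map_one, Module.End.one_apply]
    split_ifs <;> simp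
  | L_L i j =>
    simp only [map_mul, FreeAlgebra.lift_ι_apply, Module.End.mul_apply, natGen_L]
    ring
  | L_E i k =>
    simp only [map_mul, map_smul, FreeAlgebra.lift_ι_apply, Module.End.mul_apply,
      LinearMap.smul_apply, Pi.smul_apply, smul_eq_mul, natGen_L, natGen_E, form_simpleRoot_eps]
    simp only [Fin.ext_iff, lo, hi]
    split_ifs <;> first | omega | simp [h0]
  | L_F i k =>
    simp only [map_mul, map_smul, FreeAlgebra.lift_ι_apply, Module.End.mul_apply,
      LinearMap.smul_apply, Pi.smul_apply, smul_eq_mul, natGen_L, natGen_F, form_simpleRoot_eps]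
    simp only [Fin.ext_iff, lo, hi]
    split_ifs <;> first | omega | simp [h0]
  | E_F_ne j k h =>
    simp only [map_mul, FreeAlgebra.lift_ι_apply, Module.End.mul_apply, natGen_E, natGen_F,
      hi_inj, lo_inj, h, Ne.symm h, if_false, ite_self]
  | E_F_eq k =>
    simp only [map_mul, map_add, map_sub, map_smul, FreeAlgebra.lift_ι_apply,
      Module.End.mul_apply, LinearMap.add_apply, Pi.add_apply, LinearMap.sub_apply, Pi.sub_apply,
      LinearMap.smul_apply, Pi.smul_apply, smul_eq_mul, natGen_E, natGen_F, natGen_L, natGen_Linv]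
    have hlh := lo_ne_hi k
    by_cases hl : l = lo k
    · subst hl
      simp only [hlh, if_true, if_false]
      linear_combination (-f (lo k)) * inv_mul_cancel₀ h1
    · by_cases hh : l = hi k
      · subst hh
        simp only [hlh.symm, if_true, if_false]
        linear_combination f (hi k) * inv_mul_cancel₀ h1
      · simp [hl, hh]
  | E_E j k h =>
    simp only [map_mul, FreeAlgebra.lift_ι_apply, Module.End.mul_apply, natGen_E]
    unfold Distant at h
    simp only [Fin.ext_iff, lo, hi]
    split_ifs <;> first | omega | rfl
  | F_F j k h =>
    simp only [map_mul, FreeAlgebra.lift_ι_apply, Module.End.mul_apply, natGen_F]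
    unfold Distant at h
    simp only [Fin.ext_iff, lo, hi]
    split_ifs <;> first | omega | rfl
  | serre_E j k h =>
    simp only [serre, map_mul, map_add, map_sub, map_smul, map_zero, FreeAlgebra.lift_ι_apply,
      Module.End.mul_apply, LinearMap.add_apply, Pi.add_apply, LinearMap.sub_apply, Pi.sub_apply,
      LinearMap.smul_apply, Pi.smul_apply, smul_eq_mul, natGen_E, LinearMap.zero_apply,
      Pi.zero_apply]
    unfold Adjacent at h
    simp only [Fin.ext_iff, lo, hi]
    split_ifs <;> first | omega | simp
  | serre_F j k h =>
    simp only [serre, map_mul, map_add, map_sub, map_smul, map_zero, FreeAlgebra.lift_ι_apply,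
      Module.End.mul_apply, LinearMap.add_apply, Pi.add_apply, LinearMap.sub_apply, Pi.sub_apply,
      LinearMap.smul_apply, Pi.smul_apply, smul_eq_mul, natGen_F, LinearMap.zero_apply,
      Pi.zero_apply]
    unfold Adjacent at h
    simp only [Fin.ext_iff, lo, hi]
    split_ifs <;> first | omega | simp

/-- The natural representation of `U_q(gl_n)` on `ℂⁿ`. -/
def natRep (hq : ¬ IsOfFinOrder q) : Uq n q →ₐ[ℂ] Module.End ℂ (Fin n → ℂ) :=
  RingQuot.liftAlgHom ℂ ⟨FreeAlgebra.lift ℂ (natGen n q), fun _ _ h => natGen_rel hq h⟩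

theorem natRep_toUq (hq : ¬ IsOfFinOrder q) (g : Gen n) :
    natRep hq (toUq n q (fr g)) = natGen n q g :=
  (RingQuot.liftAlgHom_mkAlgHom_apply ℂ _ _ _).trans (FreeAlgebra.lift_ι_apply _ _)

variable {V : Type*} [AddCommGroup V] [Module ℂ V] [Module (Uq n q) V]
  [IsScalarTower ℂ (Uq n q) V]

variable (q) in
/-- The generators of `U_q` act on the basis `v` as on the standard basis of the natural module. -/
structure IsNatural (v : Module.Basis (Fin n) ℂ V) : Prop where
  E_smul : ∀ k i, (E k : Uq n q) • v i = if i = hi k then v (lo k) else 0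
  F_smul : ∀ k i, (F k : Uq n q) • v i = if i = lo k then v (hi k) else 0
  isWt : ∀ i, IsWt q (eps i) (v i)

theorem IsNatural.E_hi {v : Module.Basis (Fin n) ℂ V} (hv : IsNatural q v) (k : Fin (n - 1)) :
    (E k : Uq n q) • v (hi k) = v (lo k) := by
  rw [hv.E_smul, if_pos rfl]

theorem IsNatural.F_lo {v : Module.Basis (Fin n) ℂ V} (hv : IsNatural q v) (k : Fin (n - 1)) :
    (F k : Uq n q) • v (lo k) = v (hi k) := by
  rw [hv.F_smul, if_pos rfl]

/-- The weights `ε_i` are distinct, so a nonzero submodule contains some `v_i`; the `E_k` lead from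
it down to `v_0` and the `F_k` from there to every basis vector. -/
theorem IsNatural.isSimpleModule (hq : ¬ IsOfFinOrder q) (hn : 0 < n)
    {v : Module.Basis (Fin n) ℂ V} (hv : IsNatural q v) : IsSimpleModule (Uq n q) V := by
  have down : ∀ (N : Submodule (Uq n q) V) (m : ℕ) (hm : m < n), v ⟨m, hm⟩ ∈ N → v ⟨0, hn⟩ ∈ N := by
    intro N m
    induction m with
    | zero => exact fun _ h => h
    | succ m ih =>
      intro hm h
      refine ih (by omega) ?_
      have h1 : (E ⟨m, by omega⟩ : Uq n q) • v (hi ⟨m, by omega⟩) ∈ N := N.smul_mem _ h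
      rw [hv.E_hi] at h1
      exact h1
  have up : ∀ (N : Submodule (Uq n q) V), v ⟨0, hn⟩ ∈ N → ∀ (m : ℕ) (hm : m < n), v ⟨m, hm⟩ ∈ N := by
    intro N h m
    induction m with
    | zero => exact fun _ => h
    | succ m ih =>
      intro hm
      have h1 : (F ⟨m, by omega⟩ : Uq n q) • v (lo ⟨m, by omega⟩) ∈ N :=
        N.smul_mem _ (ih (by omega))
      rw [hv.F_lo] at h1
      exact h1
  rw [isSimpleModule_iff]
  have : Nontrivial V := ⟨v ⟨0, hn⟩, 0, v.ne_zero _⟩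
  refine ⟨fun N => or_iff_not_imp_left.2 fun hN => ?_⟩
  obtain ⟨x, hx, i, hi, hwt⟩ := exists_weight_vector hq v hv.isWt hN
  have hxi : x = v.repr x i • v i := by
    refine v.repr.injective (Finsupp.ext fun j => ?_)
    rw [map_smul, Finsupp.smul_apply, Module.Basis.repr_self, Finsupp.single_apply, smul_eq_mul]
    by_cases hij : i = j
    · simp [hij]
    · rw [if_neg hij, mul_zero]
      by_contra hj
      have := congrFun (hwt j hj) i
      simp [eps, hij] at this
  have hvi : v i ∈ N := by
    have h1 := N.smul_mem (algebraMap ℂ (Uq n q) (v.repr x i)⁻¹) hx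
    rwa [algebraMap_smul, hxi, smul_smul, ← hxi, inv_mul_cancel₀ hi, one_smul] at h1
  have hall := up N (down N i i.2 hvi)
  rw [eq_top_iff]
  intro y _
  rw [← v.sum_repr y]
  refine N.sum_mem fun j _ => ?_
  rw [← algebraMap_smul (Uq n q) (v.repr y j)]
  exact N.smul_mem _ (hall j j.2)

/-- The simple module `L(ε_1)` is the natural module. -/
theorem exists_isNatural (hq : ¬ IsOfFinOrder q) (hn : 0 < n) :
    ∃ v : Module.Basis (Fin n) ℂ (Simple n q (eps ⟨0, hn⟩)), IsNatural q v := by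
  let _ : Module (Uq n q) (Fin n → ℂ) := Module.compHom _ (natRep hq).toRingHom
  have hsmul : ∀ (u : Uq n q) (f : Fin n → ℂ), u • f = natRep hq u f := fun _ _ => rfl
  have : IsScalarTower ℂ (Uq n q) (Fin n → ℂ) :=
    ⟨fun c u f => by rw [hsmul, hsmul, map_smul, LinearMap.smul_apply]⟩
  have hnat : IsNatural q (Pi.basisFun ℂ (Fin n)) := by
    refine ⟨fun k i => ?_, fun k i => ?_, fun i j => ?_⟩
    · rw [hsmul, E, natRep_toUq]
      refine funext fun l => ?_
      rw [natGen_E]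
      split_ifs <;> simp_all [eq_comm]
    · rw [hsmul, F, natRep_toUq]
      refine funext fun l => ?_
      rw [natGen_F]
      split_ifs <;> simp_all [eq_comm]
    · rw [hsmul, L, natRep_toUq]
      refine funext fun l => ?_
      rw [natGen_L]
      simp only [Pi.basisFun_apply, eps, Pi.single_apply, Pi.smul_apply, smul_eq_mul]
      split_ifs <;> simp_all
  have := hnat.isSimpleModule hq hn
  -- The highest weight vector is `v_0`: the index `0` is never of the form `hi k`, so every `E_k`
  -- kills it.
  obtain ⟨e⟩ := nonempty_equiv_simple hq (hnat.isWt ⟨0, hn⟩)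
    (fun k => by rw [hnat.E_smul, if_neg (by simp [hi])]) (Module.Basis.ne_zero _ _)
  refine ⟨(Pi.basisFun ℂ (Fin n)).map (e.restrictScalars ℂ), ⟨fun k i => ?_, fun k i => ?_,
    fun i j => ?_⟩⟩
  · simp only [Module.Basis.map_apply, LinearEquiv.restrictScalars_apply, ← map_smul, hnat.E_smul]
    split_ifs <;> simp
  · simp only [Module.Basis.map_apply, LinearEquiv.restrictScalars_apply, ← map_smul, hnat.F_smul]
    split_ifs <;> simp
  · simp only [Module.Basis.map_apply, LinearEquiv.restrictScalars_apply]
    rw [← map_smul, hnat.isWt i j]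
    exact map_smul (e.restrictScalars ℂ) _ _

end Natural

/-! ### The explicit operator on the tensor square -/

section TensorSquare

variable {n : ℕ} {q : ℂˣ} {V W : Type*} [AddCommGroup V] [Module ℂ V] [Module (Uq n q) V]
  [IsScalarTower ℂ (Uq n q) V] [AddCommGroup W] [Module ℂ W] [Module (Uq n q) W]
  [IsScalarTower ℂ (Uq n q) W]

theorem tensorAct_tmul (a b : Uq n q) (x : V) (y : W) :
    tensorAct n q V W (a ⊗ₜ b) (x ⊗ₜ y) = (a • x) ⊗ₜ (b • y) := by
  simp [tensorAct, Module.endTensorEndAlgHom]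

variable (n q) in
/-- The pure tensor `x ⊗ y`, in the `U_q`-module `V ⊗ W`. -/
def tm (x : V) (y : W) : Tens n q V W := x ⊗ₜ[ℂ] y

theorem E_smul_tm (k : Fin (n - 1)) (x : V) (y : W) : (E k : Uq n q) • tm n q x y =
    tm n q ((E k : Uq n q) • x) y + tm n q ((K k : Uq n q) • x) ((E k : Uq n q) • y) := by
  refine (congrArg (fun z => tensorAct n q V W z (x ⊗ₜ y)) (comul_E k)).trans ?_
  rw [map_add, LinearMap.add_apply, tensorAct_tmul, tensorAct_tmul, one_smul]
  rfl

theorem F_smul_tm (k : Fin (n - 1)) (x : V) (y : W) : (F k : Uq n q) • tm n q x y =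
    tm n q ((F k : Uq n q) • x) ((Kinv k : Uq n q) • y) + tm n q x ((F k : Uq n q) • y) := by
  refine (congrArg (fun z => tensorAct n q V W z (x ⊗ₜ y)) (comul_F k)).trans ?_
  rw [map_add, LinearMap.add_apply, tensorAct_tmul, tensorAct_tmul, one_smul]
  rfl

theorem L_smul_tm (i : Fin n) (x : V) (y : W) : (L i : Uq n q) • tm n q x y =
    tm n q ((L i : Uq n q) • x) ((L i : Uq n q) • y) := by
  refine (congrArg (fun z => tensorAct n q V W z (x ⊗ₜ y)) (comul_L i)).trans ?_
  rw [tensorAct_tmul]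
  rfl

theorem smul_tm (c : ℂ) (x : V) (y : W) : tm n q (c • x) y = c • tm n q x y :=
  (TensorProduct.smul_tmul' c x y).symm

theorem tm_smul (c : ℂ) (x : V) (y : W) : tm n q x (c • y) = c • tm n q x y :=
  TensorProduct.tmul_smul c x y

theorem zero_tm (y : W) : tm n q (0 : V) y = 0 := TensorProduct.zero_tmul V y

theorem tm_zero (x : V) : tm n q x (0 : W) = 0 := TensorProduct.tmul_zero W x

theorem IsWt.tm {a b : Weight n} {x : V} {y : W} (hx : IsWt q a x) (hy : IsWt q b y) :
    IsWt q (a + b) (tm n q x y) := by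
  intro i
  rw [L_smul_tm, hx, hy, smul_tm, tm_smul, smul_smul, ← zpow_add₀ q.ne_zero, Pi.add_apply]

variable (v : Module.Basis (Fin n) ℂ V)

variable (q) in
/-- The basis `v_i ⊗ v_j` of `V ⊗ V`. -/
def tensBasis : Module.Basis (Fin n × Fin n) ℂ (Tens n q V V) := v.tensorProduct v

variable (q) in
/-- The basis vector `v_i ⊗ v_j`. -/
def vv (i j : Fin n) : Tens n q V V := tm n q (v i) (v j)

theorem tensBasis_apply (p : Fin n × Fin n) : tensBasis q v p = vv q v p.1 p.2 :=
  Module.Basis.tensorProduct_apply' v v p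

variable (q) in
/-- The eigenvalue of `K_k` on `v_i`. -/
def kval (k : Fin (n - 1)) (i : Fin n) : ℂ :=
  if i = lo k then (q : ℂ) else if i = hi k then (q : ℂ)⁻¹ else 1

variable (q) in
/-- The linear map `R_{VV}`, for the natural module `V`. -/
def rMap : Tens n q V V →ₗ[ℂ] Tens n q V V :=
  (tensBasis q v).constr ℂ fun p => (if p.1 = p.2 then (q : ℂ) else 1) • vv q v p.2 p.1 +
    (if p.1 < p.2 then (q : ℂ) - (q : ℂ)⁻¹ else 0) • vv q v p.1 p.2

theorem rMap_vv (i j : Fin n) : rMap q v (vv q v i j) =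
    (if i = j then (q : ℂ) else 1) • vv q v j i +
      (if i < j then (q : ℂ) - (q : ℂ)⁻¹ else 0) • vv q v i j := by
  rw [← tensBasis_apply v (i, j), rMap, Module.Basis.constr_basis, tensBasis_apply]

/-- The Hecke relation. On the span of `v_i ⊗ v_j` and `v_j ⊗ v_i` it is a two-by-two computation.
It also exhibits `R - (q - q⁻¹)` as the inverse of `R`. -/
theorem rMap_rMap (x : Tens n q V V) :
    rMap q v (rMap q v x) = ((q : ℂ) - (q : ℂ)⁻¹) • rMap q v x + x := by
  have h : rMap q v ∘ₗ rMap q v = ((q : ℂ) - (q : ℂ)⁻¹) • rMap q v + LinearMap.id := by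
    refine (tensBasis q v).ext fun ⟨i, j⟩ => ?_
    have h0 := q.ne_zero
    simp only [tensBasis_apply, LinearMap.comp_apply, LinearMap.add_apply, LinearMap.smul_apply,
      LinearMap.id_apply, rMap_vv, map_add, map_smul]
    rcases lt_trichotomy i j with hij | rfl | hij
    · simp only [hij, hij.ne, hij.ne', hij.not_gt, if_true, if_false]
      module
    · simp only [lt_self_iff_false, if_true, if_false]
      match_scalars
      field_simp
      ring
    · simp only [hij, hij.ne, hij.ne', hij.not_gt, if_true, if_false]
      module
  exact LinearMap.congr_fun h x

variable {v}

theorem IsNatural.K_smul (hv : IsNatural q v) (k : Fin (n - 1)) (i : Fin n) :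
    (K k : Uq n q) • v i = kval q k i • v i := by
  rw [(hv.isWt i).K_smul, kval]
  have := lo_ne_hi k
  split_ifs with h1 h2
  · subst h1; simp [eps, this.symm]
  · subst h2; simp [eps, this]
  · simp [eps, Ne.symm h1, Ne.symm h2]

theorem IsNatural.Kinv_smul (hv : IsNatural q v) (k : Fin (n - 1)) (i : Fin n) :
    (Kinv k : Uq n q) • v i = (kval q k i)⁻¹ • v i := by
  rw [(hv.isWt i).Kinv_smul, kval]
  have := lo_ne_hi k
  split_ifs with h1 h2
  · subst h1; simp [eps, this.symm]
  · subst h2; simp [eps, this]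
  · simp [eps, Ne.symm h1, Ne.symm h2]

theorem IsNatural.isWt_vv (hv : IsNatural q v) (i j : Fin n) :
    IsWt q (eps i + eps j) (vv q v i j) := (hv.isWt i).tm (hv.isWt j)

theorem IsNatural.E_smul_vv (hv : IsNatural q v) (k : Fin (n - 1)) (i j : Fin n) :
    (E k : Uq n q) • vv q v i j = (if i = hi k then vv q v (lo k) j else 0) +
      kval q k i • (if j = hi k then vv q v i (lo k) else 0) := by
  rw [vv, E_smul_tm, hv.E_smul, hv.K_smul, smul_tm, hv.E_smul]
  split_ifs <;> simp [vv, zero_tm, tm_zero]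

theorem IsNatural.F_smul_vv (hv : IsNatural q v) (k : Fin (n - 1)) (i j : Fin n) :
    (F k : Uq n q) • vv q v i j = (kval q k j)⁻¹ • (if i = lo k then vv q v (hi k) j else 0) +
      (if j = lo k then vv q v i (hi k) else 0) := by
  rw [vv, F_smul_tm, hv.F_smul, hv.Kinv_smul, tm_smul, hv.F_smul]
  split_ifs <;> simp [vv, zero_tm, tm_zero]

theorem lo_lt_hi (k : Fin (n - 1)) : lo k < hi k := by simp [lo, hi]

/-- As `lo k` and `hi k` are consecutive, any other index lies on the same side of both. Replacing
one by the other then does not affect the condition `i < j` in `rMap`. -/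
theorem node_cases (k : Fin (n - 1)) (i : Fin n) : i = hi k ∨ i = lo k ∨
    (i ≠ hi k ∧ hi k ≠ i ∧ i ≠ lo k ∧ lo k ≠ i ∧ (i < hi k ↔ i < lo k) ∧
      (hi k < i ↔ lo k < i)) := by
  simp only [Ne, Fin.ext_iff, Fin.lt_def, lo, hi]
  omega

theorem IsNatural.rMap_E_smul (hv : IsNatural q v) (k : Fin (n - 1)) (x : Tens n q V V) :
    rMap q v ((E k : Uq n q) • x) = (E k : Uq n q) • rMap q v x := by
  have h : rMap q v ∘ₗ Algebra.lsmul ℂ ℂ _ (E k : Uq n q) =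
      Algebra.lsmul ℂ ℂ _ (E k : Uq n q) ∘ₗ rMap q v := by
    refine (tensBasis q v).ext fun ⟨i, j⟩ => ?_
    have h0 := q.ne_zero
    have h1 := lo_lt_hi k
    have h2 := h1.ne
    have h3 := h1.ne'
    have h4 := h1.not_gt
    simp only [tensBasis_apply, LinearMap.comp_apply, Algebra.lsmul_coe]
    -- Nine cases, according to whether `i` and `j` are `hi k`, `lo k` or neither; each is an
    -- identity between coefficients in `q`.
    rcases node_cases k i with rfl | rfl | ⟨i1, i2, i3, i4, i5, i6⟩ <;>
    rcases node_cases k j with rfl | rfl | ⟨j1, j2, j3, j4, j5, j6⟩ <;>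
    simp only [hv.E_smul_vv, rMap_vv, smul_add, smul_comm (E k : Uq n q), map_add, map_smul,
      map_zero, *, if_true, if_false, kval, lt_self_iff_false, smul_zero, add_zero, zero_add] <;>
    (try split_ifs) <;> match_scalars <;> field_simp <;> ring
  exact LinearMap.congr_fun h x

theorem IsNatural.rMap_F_smul (hv : IsNatural q v) (k : Fin (n - 1)) (x : Tens n q V V) :
    rMap q v ((F k : Uq n q) • x) = (F k : Uq n q) • rMap q v x := by
  have h : rMap q v ∘ₗ Algebra.lsmul ℂ ℂ _ (F k : Uq n q) =
      Algebra.lsmul ℂ ℂ _ (F k : Uq n q) ∘ₗ rMap q v := by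
    refine (tensBasis q v).ext fun ⟨i, j⟩ => ?_
    have h0 := q.ne_zero
    have h1 := lo_lt_hi k
    have h2 := h1.ne
    have h3 := h1.ne'
    have h4 := h1.not_gt
    simp only [tensBasis_apply, LinearMap.comp_apply, Algebra.lsmul_coe]
    rcases node_cases k i with rfl | rfl | ⟨i1, i2, i3, i4, i5, i6⟩ <;>
    rcases node_cases k j with rfl | rfl | ⟨j1, j2, j3, j4, j5, j6⟩ <;>
    simp only [hv.F_smul_vv, rMap_vv, smul_add, smul_comm (F k : Uq n q), map_add, map_smul,
      map_zero, *, if_true, if_false, kval, lt_self_iff_false, smul_zero, add_zero, zero_add] <;>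
    (try split_ifs) <;> match_scalars <;> field_simp <;> ring
  exact LinearMap.congr_fun h x

theorem IsNatural.rMap_L_smul (hv : IsNatural q v) (l : Fin n) (x : Tens n q V V) :
    rMap q v ((L l : Uq n q) • x) = (L l : Uq n q) • rMap q v x := by
  have h : rMap q v ∘ₗ Algebra.lsmul ℂ ℂ _ (L l : Uq n q) =
      Algebra.lsmul ℂ ℂ _ (L l : Uq n q) ∘ₗ rMap q v := by
    refine (tensBasis q v).ext fun ⟨i, j⟩ => ?_
    simp only [tensBasis_apply, LinearMap.comp_apply, Algebra.lsmul_coe]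
    rw [hv.isWt_vv i j l, map_smul, rMap_vv, smul_add, smul_add, smul_comm (L l : Uq n q),
      smul_comm (L l : Uq n q), hv.isWt_vv i j l, hv.isWt_vv j i l, add_comm (eps j)]
    simp only [smul_comm ((q : ℂ) ^ (eps i + eps j : Weight n) l)]
  exact LinearMap.congr_fun h x

theorem IsNatural.rMap_smul (hv : IsNatural q v) (u : Uq n q) (x : Tens n q V V) :
    rMap q v (u • x) = u • rMap q v x :=
  map_smul_of_generators (rMap q v) hv.rMap_E_smul hv.rMap_F_smul hv.rMap_L_smul u x

variable (v) in
theorem rMap_leftInverse : Function.LeftInverse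
    (fun x => rMap q v x - ((q : ℂ) - (q : ℂ)⁻¹) • x) (rMap q v) := fun x => by
  dsimp only; rw [rMap_rMap, add_sub_cancel_left]

/-- The map `R_{VV}` as an automorphism of the `U_q`-module `V ⊗ V`. -/
def IsNatural.rEquiv (hv : IsNatural q v) : Tens n q V V ≃ₗ[Uq n q] Tens n q V V where
  toFun := rMap q v
  map_add' := map_add _
  map_smul' u x := hv.rMap_smul u x
  invFun x := rMap q v x - ((q : ℂ) - (q : ℂ)⁻¹) • x
  left_inv := rMap_leftInverse v
  right_inv x := by rw [map_sub, map_smul, rMap_rMap, add_sub_cancel_left]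

end TensorSquare

/-! ### The two eigenspaces, their simplicity and their highest weights -/

section Eigenspaces

variable {n : ℕ} {q : ℂˣ} {V : Type*} [AddCommGroup V] [Module ℂ V] [Module (Uq n q) V]
  [IsScalarTower ℂ (Uq n q) V] {v : Module.Basis (Fin n) ℂ V}

theorem complex_smul_mem {M : Type*} [AddCommGroup M] [Module ℂ M] [Module (Uq n q) M]
    [IsScalarTower ℂ (Uq n q) M] (N : Submodule (Uq n q) M) (c : ℂ) {x : M} (hx : x ∈ N) :
    c • x ∈ N := by
  rw [← algebraMap_smul (Uq n q) c]; exact N.smul_mem _ hx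

theorem mem_of_complex_smul_mem {M : Type*} [AddCommGroup M] [Module ℂ M]
    [Module (Uq n q) M] [IsScalarTower ℂ (Uq n q) M] (N : Submodule (Uq n q) M) {c : ℂ}
    (hc : c ≠ 0) {x : M} (hx : c • x ∈ N) : x ∈ N := by
  have := complex_smul_mem N c⁻¹ hx
  rwa [smul_smul, inv_mul_cancel₀ hc, one_smul] at this

/-- The eigenspace of `R_{VV}` for the eigenvalue `t`, as a `U_q`-submodule. -/
def IsNatural.eigen (hv : IsNatural q v) (t : ℂ) : Submodule (Uq n q) (Tens n q V V) where
  carrier := {x | rMap q v x = t • x}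
  add_mem' {x y} hx hy := by
    rw [Set.mem_ofPred_eq] at *; rw [map_add, hx, hy, smul_add]
  zero_mem' := by simp
  smul_mem' u x hx := by
    rw [Set.mem_ofPred_eq] at *; rw [hv.rMap_smul, hx, smul_comm]

theorem IsNatural.mem_eigen (hv : IsNatural q v) {t : ℂ} {x : Tens n q V V} :
    x ∈ hv.eigen t ↔ rMap q v x = t • x := Iff.rfl

variable (q v) in
/-- The map `R_{VV} + t⁻¹`: if `t - t⁻¹ = q - q⁻¹`, a multiple of a projection to the eigenspace for
`t`. -/
def eigenMap (t : ℂ) : Tens n q V V →ₗ[ℂ] Tens n q V V := rMap q v + t⁻¹ • LinearMap.id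

variable (q v) in
/-- The image of `v_i ⊗ v_j` under `R_{VV} + t⁻¹`. -/
def ee (t : ℂ) (i j : Fin n) : Tens n q V V := eigenMap q v t (vv q v i j)

theorem eigenMap_apply (t : ℂ) (x : Tens n q V V) :
    eigenMap q v t x = rMap q v x + t⁻¹ • x := rfl

theorem IsNatural.eigenMap_smul (hv : IsNatural q v) (t : ℂ) (u : Uq n q) (x : Tens n q V V) :
    eigenMap q v t (u • x) = u • eigenMap q v t x := by
  rw [eigenMap_apply, eigenMap_apply, hv.rMap_smul, smul_add, smul_comm u]

theorem IsNatural.E_smul_ee (hv : IsNatural q v) (t : ℂ) (k : Fin (n - 1)) (i j : Fin n) :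
    (E k : Uq n q) • ee q v t i j = (if i = hi k then ee q v t (lo k) j else 0) +
      kval q k i • (if j = hi k then ee q v t i (lo k) else 0) := by
  rw [ee, ← hv.eigenMap_smul, hv.E_smul_vv, map_add, map_smul, apply_ite (eigenMap q v t),
    apply_ite (eigenMap q v t), map_zero]
  rfl

theorem IsNatural.F_smul_ee (hv : IsNatural q v) (t : ℂ) (k : Fin (n - 1)) (i j : Fin n) :
    (F k : Uq n q) • ee q v t i j = (kval q k j)⁻¹ • (if i = lo k then ee q v t (hi k) j else 0) +
      (if j = lo k then ee q v t i (hi k) else 0) := by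
  rw [ee, ← hv.eigenMap_smul, hv.F_smul_vv, map_add, map_smul, apply_ite (eigenMap q v t),
    apply_ite (eigenMap q v t), map_zero]
  rfl

theorem IsNatural.isWt_ee (hv : IsNatural q v) (t : ℂ) (i j : Fin n) :
    IsWt q (eps i + eps j) (ee q v t i j) := fun l => by
  rw [ee, ← hv.eigenMap_smul, hv.isWt_vv, map_smul]

/-- The coefficient is what distinguishes the two eigenspaces: it is `q + q⁻¹ ≠ 0` for `t = q` and
`0` for `t = -q⁻¹`, as for a symmetric and an exterior square. -/
theorem ee_self (t : ℂ) (i : Fin n) : ee q v t i i = ((q : ℂ) + t⁻¹) • vv q v i i := by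
  rw [ee, eigenMap_apply, rMap_vv, if_pos rfl, if_neg (lt_irrefl i)]
  module

section

variable {t : ℂ} (ht : t ≠ 0) (hqt : t - t⁻¹ = (q : ℂ) - (q : ℂ)⁻¹)
include ht hqt

theorem ee_of_lt {i j : Fin n} (h : i < j) :
    ee q v t i j = vv q v j i + t • vv q v i j := by
  rw [ee, eigenMap_apply, rMap_vv, if_neg h.ne, if_pos h, ← hqt]
  module

theorem ee_swap {i j : Fin n} (h : i < j) : ee q v t j i = t⁻¹ • ee q v t i j := by
  rw [ee_of_lt ht hqt h, ee, eigenMap_apply, rMap_vv, if_neg h.ne', if_neg h.not_gt, smul_add,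
    smul_smul, inv_mul_cancel₀ ht]
  module

/-- The weight `ε_i + ε_j` determines the unordered pair, and swapping the indices only costs a
power of `t`. So each weight contributes at most a line to the eigenspace. -/
theorem exists_ee_eq_smul {i j : Fin n} {k l : Fin n}
    (h : (eps i + eps j : Weight n) = eps k + eps l) :
    ∃ c : ℂ, c ≠ 0 ∧ ee q v t i j = c • ee q v t k l := by
  have hcases : (i = k ∧ j = l) ∨ (i = l ∧ j = k) := by
    have h1 := congrFun h i
    have h2 := congrFun h j
    have h3 := congrFun h k
    have h4 := congrFun h l
    simp only [Pi.add_apply, eps, Pi.single_apply] at h1 h2 h3 h4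
    by_cases a : i = k
    · subst a
      refine Or.inl ⟨rfl, ?_⟩
      by_contra b
      simp [b] at h2
    · have a' := Ne.symm a
      by_cases b : i = l
      · subst b
        refine Or.inr ⟨rfl, ?_⟩
        by_contra c
        simp [c] at h2
      · simp [a, b] at h1
        split_ifs at h1 <;> omega
  rcases hcases with ⟨rfl, rfl⟩ | ⟨rfl, rfl⟩
  · exact ⟨1, one_ne_zero, (one_smul _ _).symm⟩
  · rcases lt_trichotomy i j with hij | rfl | hij
    · exact ⟨t, ht, by rw [ee_swap ht hqt hij, smul_smul, mul_inv_cancel₀ ht, one_smul]⟩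
    · exact ⟨1, one_ne_zero, (one_smul _ _).symm⟩
    · exact ⟨t⁻¹, inv_ne_zero ht, ee_swap ht hqt hij⟩

/-- With `t - t⁻¹ = q - q⁻¹` the Hecke relation factors as `(R - t)(R + t⁻¹) = 0`. -/
theorem IsNatural.eigenMap_mem (hv : IsNatural q v) (x : Tens n q V V) :
    eigenMap q v t x ∈ hv.eigen t := by
  rw [hv.mem_eigen, eigenMap_apply, map_add, map_smul, rMap_rMap, ← hqt]
  match_scalars <;> field_simp
  ring

theorem IsNatural.eigenMap_eq (hv : IsNatural q v) {x : Tens n q V V} (hx : x ∈ hv.eigen t) :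
    eigenMap q v t x = (t + t⁻¹) • x := by
  rw [eigenMap_apply, hv.mem_eigen.1 hx, add_smul]

variable (hv : IsNatural q v) (N : Submodule (Uq n q) (Tens n q V V))
include hv

/-- The first index is lowered to `0` while it stays below `j`, then the second to `1`. In this
order each `E_k` meets only one of the two factors, and the `K_k` that appears in the second phase
acts by `1`. -/
theorem ee_zero_one_mem (hn : 2 ≤ n) {i j : Fin n} (hij : i < j) (h : ee q v t i j ∈ N) :
    ee q v t ⟨0, by omega⟩ ⟨1, hn⟩ ∈ N := by
  have h1 : ∀ (m : ℕ) (hm : m < j), ee q v t ⟨m, by omega⟩ j ∈ N →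
      ee q v t ⟨0, by omega⟩ j ∈ N := by
    intro m
    induction m with
    | zero => exact fun _ h => h
    | succ m ih =>
      intro hm h
      refine ih (by omega) ?_
      let k : Fin (n - 1) := ⟨m, by omega⟩
      have h2 : (E k : Uq n q) • ee q v t (hi k) j ∈ N := N.smul_mem _ h
      rwa [hv.E_smul_ee, if_pos rfl, if_neg (fun h => by rw [h] at hm; exact lt_irrefl _ hm),
        smul_zero, add_zero] at h2
  have h2 : ∀ (m : ℕ) (hm : m + 1 < n), ee q v t ⟨0, by omega⟩ ⟨m + 1, hm⟩ ∈ N →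
      ee q v t ⟨0, by omega⟩ ⟨1, hn⟩ ∈ N := by
    intro m
    induction m with
    | zero => exact fun _ h => h
    | succ m ih =>
      intro hm h
      refine ih (by omega) ?_
      let k : Fin (n - 1) := ⟨m + 1, by omega⟩
      have h2 : (E k : Uq n q) • ee q v t ⟨0, by omega⟩ (hi k) ∈ N := N.smul_mem _ h
      have h3 : (⟨0, by omega⟩ : Fin n) ≠ lo k := by simp [k, lo]
      have h4 : (⟨0, by omega⟩ : Fin n) ≠ hi k := by simp [hi]
      rwa [hv.E_smul_ee, if_neg h4, if_pos rfl, kval, if_neg h3, if_neg h4, one_smul,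
        zero_add] at h2
  obtain ⟨j, hj⟩ := j
  obtain ⟨m, rfl⟩ : ∃ m, j = m + 1 := ⟨j - 1, by have := Fin.lt_def.1 hij; simp at this; omega⟩
  exact h2 m hj (h1 i hij h)

theorem ee_mem_of_zero_one_mem (hn : 2 ≤ n) (h : ee q v t ⟨0, by omega⟩ ⟨1, hn⟩ ∈ N) {i j : Fin n}
    (hij : i < j) : ee q v t i j ∈ N := by
  have h2 : ∀ (m : ℕ) (hm : m + 1 < n), ee q v t ⟨0, by omega⟩ ⟨m + 1, hm⟩ ∈ N := by
    intro m
    induction m with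
    | zero => exact fun _ => h
    | succ m ih =>
      intro hm
      let k : Fin (n - 1) := ⟨m + 1, by omega⟩
      have h2 : (F k : Uq n q) • ee q v t ⟨0, by omega⟩ (lo k) ∈ N :=
        N.smul_mem _ (ih (by omega))
      have h3 : (⟨0, by omega⟩ : Fin n) ≠ lo k := by simp [k, lo]
      rwa [hv.F_smul_ee, if_neg h3, if_pos rfl, smul_zero, zero_add] at h2
  have h1 : ∀ (m : ℕ) (hm : m < j), ee q v t ⟨m, by omega⟩ j ∈ N := by
    intro m
    induction m with
    | zero =>
      intro hm
      obtain ⟨j, hj⟩ := j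
      obtain ⟨m, rfl⟩ : ∃ m, j = m + 1 := ⟨j - 1, by simp at hm; omega⟩
      exact h2 m hj
    | succ m ih =>
      intro hm
      let k : Fin (n - 1) := ⟨m, by omega⟩
      have h2 : (F k : Uq n q) • ee q v t (lo k) j ∈ N := N.smul_mem _ (ih (by omega))
      have h3 : j ≠ lo k := fun h => by rw [h] at hm; simp [k, lo] at hm
      have h4 : j ≠ hi k := fun h => by rw [h] at hm; simp [k, hi] at hm
      rwa [hv.F_smul_ee, if_pos rfl, if_neg h3, kval, if_neg h3, if_neg h4, inv_one, one_smul,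
        add_zero] at h2
  exact h1 i hij

/-- All off-diagonal vectors are reached through the pair `(0, 1)`. The diagonal ones are tied to
them by a single generator: `E_m` and `F_m` map the vector at `(lo m, hi m)` to `q` times those at
`(lo m, lo m)` and `(hi m, hi m)`. -/
theorem ee_mem_of_ne_zero {i j : Fin n} (h : ee q v t i j ∈ N) (h0 : ee q v t i j ≠ 0)
    (k l : Fin n) : ee q v t k l ∈ N := by
  rcases lt_or_ge n 2 with hn | hn
  · have : Subsingleton (Fin n) := ⟨fun a b => Fin.ext (by omega)⟩
    rwa [Subsingleton.elim k i, Subsingleton.elim l j]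
  have node : ∀ i : Fin n, ∃ k : Fin (n - 1), i = lo k ∨ i = hi k := by
    intro i
    by_cases hi0 : (i : ℕ) = 0
    · exact ⟨⟨0, by omega⟩, Or.inl (Fin.ext hi0)⟩
    · exact ⟨⟨i - 1, by omega⟩, Or.inr (Fin.ext (by simp only [hi]; omega))⟩
  have h01 : ee q v t ⟨0, by omega⟩ ⟨1, hn⟩ ∈ N := by
    rcases lt_trichotomy i j with hij | rfl | hij
    · exact ee_zero_one_mem ht hqt hv N hn hij h
    · have hq0 := q.ne_zero
      -- This is the coefficient that appears when a generator maps the diagonal vector to the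
      -- vector at `(lo k, hi k)`. It is `q⁻¹` times the coefficient in `ee_self`, hence nonzero
      -- because the diagonal vector is.
      have hc : 1 + (q : ℂ)⁻¹ * t⁻¹ ≠ 0 := by
        intro hc
        refine h0 ?_
        rw [ee_self]
        have : (q : ℂ) + t⁻¹ = 0 := by
          field_simp at hc ⊢
          linear_combination hc
        rw [this, zero_smul]
      obtain ⟨k, rfl | rfl⟩ := node i
      · refine ee_zero_one_mem ht hqt hv N hn (lo_lt_hi k) ?_
        have h1 := N.smul_mem (F k) h
        rw [hv.F_smul_ee, if_pos rfl, if_pos rfl, kval, if_pos rfl, ee_swap ht hqt (lo_lt_hi k),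
          smul_smul] at h1
        refine mem_of_complex_smul_mem N hc ?_
        rwa [add_smul, one_smul, add_comm]
      · refine ee_zero_one_mem ht hqt hv N hn (lo_lt_hi k) ?_
        have h1 := N.smul_mem (E k) h
        rw [hv.E_smul_ee, if_pos rfl, if_pos rfl, kval, if_neg (lo_lt_hi k).ne', if_pos rfl,
          ee_swap ht hqt (lo_lt_hi k), smul_smul] at h1
        refine mem_of_complex_smul_mem N hc ?_
        rwa [add_smul, one_smul]
    · refine ee_zero_one_mem ht hqt hv N hn hij ?_
      rw [ee_swap ht hqt hij] at h
      exact mem_of_complex_smul_mem N (inv_ne_zero ht) h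
  have hlt : ∀ {k l : Fin n}, k < l → ee q v t k l ∈ N := fun hkl =>
    ee_mem_of_zero_one_mem ht hqt hv N hn h01 hkl
  rcases lt_trichotomy k l with hkl | rfl | hkl
  · exact hlt hkl
  · obtain ⟨m, rfl | rfl⟩ := node k
    · have h1 := N.smul_mem (E m) (hlt (lo_lt_hi m))
      rw [hv.E_smul_ee, if_neg (lo_lt_hi m).ne, if_pos rfl, kval, if_pos rfl, zero_add] at h1
      exact mem_of_complex_smul_mem N q.ne_zero h1
    · have h1 := N.smul_mem (F m) (hlt (lo_lt_hi m))
      rw [hv.F_smul_ee, if_neg (lo_lt_hi m).ne', if_pos rfl, kval, if_neg (lo_lt_hi m).ne',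
        if_pos rfl, add_zero, inv_inv] at h1
      exact mem_of_complex_smul_mem N q.ne_zero h1
  · rw [ee_swap ht hqt hkl]
    exact complex_smul_mem N _ (hlt hkl)

theorem eigenMap_eq_sum (x : Tens n q V V) : eigenMap q v t x =
    ∑ p, (tensBasis q v).repr x p • ee q v t p.1 p.2 := by
  conv_lhs => rw [← (tensBasis q v).sum_repr x]
  rw [map_sum]
  exact Finset.sum_congr rfl fun p _ => by rw [map_smul, tensBasis_apply, ee]

/-- A nonzero submodule `N` contains a nonzero weight vector `y`. On the eigenspace `R + t⁻¹` is the
nonzero scalar `t + t⁻¹`, yet it sends `y` to a multiple of one `ee`. That vector is therefore in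
`N`, and with it all the others, which span the eigenspace. -/
theorem isSimpleModule_eigen (hq : ¬ IsOfFinOrder q) (htt : t + t⁻¹ ≠ 0) {i₀ j₀ : Fin n}
    (h0 : ee q v t i₀ j₀ ≠ 0) : IsSimpleModule (Uq n q) (hv.eigen t) := by
  rw [isSimpleModule_iff_isAtom]
  refine ⟨fun h => h0 ?_, fun N hN => ?_⟩
  · have := hv.eigenMap_mem ht hqt (vv q v i₀ j₀)
    rwa [h, Submodule.mem_bot] at this
  · by_contra hbot
    refine hN.not_ge fun x hx => ?_
    have hall : ∀ k l, ee q v t k l ∈ N := by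
      obtain ⟨y, hy, ⟨i, j⟩, hij, hwt⟩ := exists_weight_vector hq (tensBasis q v)
        (wt := fun p => eps p.1 + eps p.2)
        (fun p => by rw [tensBasis_apply]; exact hv.isWt_vv _ _) hbot
      obtain ⟨c, hc⟩ : ∃ c : ℂ, eigenMap q v t y = c • ee q v t i j := by
        have hp : ∀ p : Fin n × Fin n, ∃ c : ℂ,
            (tensBasis q v).repr y p • ee q v t p.1 p.2 = c • ee q v t i j := by
          intro p
          by_cases hp : (tensBasis q v).repr y p = 0
          · exact ⟨0, by rw [hp, zero_smul, zero_smul]⟩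
          · obtain ⟨c, -, hc⟩ := exists_ee_eq_smul (v := v) ht hqt (hwt p hp)
            exact ⟨_, by rw [hc, smul_smul]⟩
        choose c hc using hp
        exact ⟨∑ p, c p, by
          rw [eigenMap_eq_sum ht hqt hv, Finset.sum_smul]
          exact Finset.sum_congr rfl fun p _ => hc p⟩
      have hy0 : y ≠ 0 := fun h => hij (by rw [h, map_zero, Finsupp.zero_apply])
      have hcy : c • ee q v t i j ≠ 0 := by
        rw [← hc, hv.eigenMap_eq ht hqt (hN.le hy)]
        exact smul_ne_zero htt hy0
      refine ee_mem_of_ne_zero ht hqt hv N ?_ (right_ne_zero_of_smul hcy)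
      refine mem_of_complex_smul_mem N (left_ne_zero_of_smul hcy) ?_
      rw [← hc, hv.eigenMap_eq ht hqt (hN.le hy)]
      exact complex_smul_mem N _ hy
    refine mem_of_complex_smul_mem N htt ?_
    rw [← hv.eigenMap_eq ht hqt hx, eigenMap_eq_sum ht hqt hv]
    exact N.sum_mem fun p _ => complex_smul_mem N _ (hall _ _)

theorem nonempty_eigen_equiv (hq : ¬ IsOfFinOrder q) (htt : t + t⁻¹ ≠ 0) {i j : Fin n}
    (h0 : ee q v t i j ≠ 0) (hE : ∀ k, (E k : Uq n q) • ee q v t i j = 0) :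
    Nonempty (hv.eigen t ≃ₗ[Uq n q] Simple n q (eps i + eps j)) := by
  have := isSimpleModule_eigen ht hqt hv hq htt h0
  refine nonempty_equiv_simple hq (m := ⟨ee q v t i j, hv.eigenMap_mem ht hqt _⟩)
    (fun l => Subtype.ext (hv.isWt_ee t i j l)) (fun k => Subtype.ext (hE k))
    fun h => h0 (congrArg Subtype.val h)

end

theorem IsNatural.nonempty_eigen_q (hv : IsNatural q v) (hq : ¬ IsOfFinOrder q) (hn : 0 < n) :
    Nonempty (hv.eigen (q : ℂ) ≃ₗ[Uq n q] Simple n q (2 • eps ⟨0, hn⟩)) := by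
  rw [two_nsmul]
  refine nonempty_eigen_equiv q.ne_zero rfl hv hq (add_inv_ne_zero hq) ?_ fun k => ?_
  · rw [ee_self, ← tensBasis_apply v (_, _)]
    exact smul_ne_zero (add_inv_ne_zero hq) (Module.Basis.ne_zero _ _)
  · have h : (⟨0, hn⟩ : Fin n) ≠ hi k := by simp [hi]
    rw [hv.E_smul_ee, if_neg h, if_neg h, smul_zero, add_zero]

theorem IsNatural.nonempty_eigen_neg_q_inv (hv : IsNatural q v) (hq : ¬ IsOfFinOrder q)
    (hn : 2 ≤ n) : Nonempty (hv.eigen (-(q : ℂ)⁻¹) ≃ₗ[Uq n q]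
      Simple n q (eps ⟨0, by omega⟩ + eps ⟨1, hn⟩)) := by
  have ht : -(q : ℂ)⁻¹ ≠ 0 := neg_ne_zero.2 (inv_ne_zero q.ne_zero)
  have hinv : (-(q : ℂ)⁻¹)⁻¹ = -(q : ℂ) := by rw [inv_neg, inv_inv]
  have hqt : -(q : ℂ)⁻¹ - (-(q : ℂ)⁻¹)⁻¹ = (q : ℂ) - (q : ℂ)⁻¹ := by rw [hinv]; ring
  have hlt : (⟨0, by omega⟩ : Fin n) < ⟨1, hn⟩ := by simp
  refine nonempty_eigen_equiv ht hqt hv hq ?_ (fun h => ?_) fun k => ?_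
  · rw [hinv, ← neg_add, add_comm]
    exact neg_ne_zero.2 (add_inv_ne_zero hq)
  · rw [ee_of_lt ht hqt hlt, ← tensBasis_apply v (_, _), ← tensBasis_apply v (_, _)] at h
    -- The coordinate at `(1, 0)` is `1`, so the vector is not zero.
    have h1 := congrArg (fun x => (tensBasis q v).repr x (⟨1, hn⟩, ⟨0, by omega⟩)) h
    simp at h1
  · have h : (⟨0, by omega⟩ : Fin n) ≠ hi k := by simp [hi]
    rw [hv.E_smul_ee, if_neg h, zero_add]
    -- Only the node `0` could act nontrivially, and it produces a multiple of the diagonal vector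
    -- at `(0, 0)`, which is zero for `t = -q⁻¹`.
    split_ifs with h1
    · have h2 : lo k = ⟨0, by omega⟩ := by
        simp only [hi, lo, Fin.ext_iff] at h1 ⊢; omega
      rw [h2, ee_self, hinv, add_neg_cancel, zero_smul, smul_zero]
    · rw [smul_zero]

theorem IsNatural.isCompl_eigen (hv : IsNatural q v) (hq : ¬ IsOfFinOrder q) :
    IsCompl (hv.eigen (q : ℂ)) (hv.eigen (-(q : ℂ)⁻¹)) := by
  have hinv : (-(q : ℂ)⁻¹)⁻¹ = -(q : ℂ) := by rw [inv_neg, inv_inv]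
  refine IsCompl.of_le (fun x ⟨hx, hx'⟩ => ?_) fun x _ => ?_
  · have h : ((q : ℂ) + (q : ℂ)⁻¹) • x = 0 := by
      rw [SetLike.mem_coe, hv.mem_eigen] at hx hx'
      rw [add_smul, ← hx, hx', neg_smul, neg_add_cancel]
    exact (smul_eq_zero.1 h).resolve_left (add_inv_ne_zero hq)
  · refine mem_of_complex_smul_mem _ (add_inv_ne_zero hq) ?_
    -- The difference of `R + q⁻¹` and `R - q`, whose images lie in the two eigenspaces.
    have h : ((q : ℂ) + (q : ℂ)⁻¹) • x =
        eigenMap q v (q : ℂ) x - eigenMap q v (-(q : ℂ)⁻¹) x := by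
      rw [eigenMap_apply, eigenMap_apply, hinv]; module
    rw [h]
    exact sub_mem (Submodule.mem_sup_left (hv.eigenMap_mem q.ne_zero rfl x))
      (Submodule.mem_sup_right (hv.eigenMap_mem (neg_ne_zero.2 (inv_ne_zero q.ne_zero))
        (by rw [hinv]; ring) x))

/-- For `n = 1` only the diagonal vector `ee` occurs, and it vanishes for `t = -q⁻¹`. -/
theorem IsNatural.eigen_eq_bot (hv : IsNatural q v) (hq : ¬ IsOfFinOrder q) (hn : n = 1) :
    hv.eigen (-(q : ℂ)⁻¹) = ⊥ := by
  have hinv : (-(q : ℂ)⁻¹)⁻¹ = -(q : ℂ) := by rw [inv_neg, inv_inv]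
  have ht : -(q : ℂ)⁻¹ ≠ 0 := neg_ne_zero.2 (inv_ne_zero q.ne_zero)
  have hqt : -(q : ℂ)⁻¹ - (-(q : ℂ)⁻¹)⁻¹ = (q : ℂ) - (q : ℂ)⁻¹ := by rw [hinv]; ring
  rw [eq_bot_iff]
  intro x hx
  have hs : Subsingleton (Fin n) := ⟨fun a b => Fin.ext (by omega)⟩
  have h := hv.eigenMap_eq ht hqt hx
  rw [eigenMap_eq_sum ht hqt hv, Finset.sum_eq_zero, hinv, ← neg_add, add_comm] at h
  · exact (smul_eq_zero.1 h.symm).resolve_left (neg_ne_zero.2 (add_inv_ne_zero hq))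
  · rintro ⟨i, j⟩ _
    rw [Subsingleton.elim j i, ee_self, hinv, add_neg_cancel, zero_smul, smul_zero]

end Eigenspaces

/-! ### The natural module in the category `O`, and the map `Π⁻¹` -/

section CategoryO

variable {n : ℕ} {q : ℂˣ} {V : Type*} [AddCommGroup V] [Module ℂ V] [Module (Uq n q) V]
  [IsScalarTower ℂ (Uq n q) V] {v : Module.Basis (Fin n) ℂ V}

/-- Weight spaces lie in simultaneous generalized eigenspaces of the commuting `L_i`. These are
independent for distinct systems of eigenvalues, and distinct weights give distinct systems since
`q` has infinite order. -/
theorem iSupIndep_weightSpace (hq : ¬ IsOfFinOrder q) (M : Type*) [AddCommGroup M] [Module ℂ M]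
    [Module (Uq n q) M] [IsScalarTower ℂ (Uq n q) M] : iSupIndep (weightSpace n q M) := by
  have h := Module.End.independent_iInf_maxGenEigenspace_of_forall_mapsTo
    (fun i => Algebra.lsmul ℂ ℂ M (L i : Uq n q)) (fun i j c => by
      refine Module.End.mapsTo_maxGenEigenspace_of_comm ?_ c
      rw [Commute, SemiconjBy, ← map_mul, ← map_mul, L_comm])
  have h2 := h.comp (f := fun (a : Weight n) i => (q : ℂ) ^ a i)
    (fun a b hab => funext fun i => zpow_inj hq (congrFun hab i))
  refine h2.mono fun a x hx => ?_
  rw [mem_weightSpace] at hx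
  simp only [Function.comp_apply, Submodule.mem_iInf]
  intro i
  refine Module.End.mem_maxGenEigenspace _ _ _ |>.2 ⟨1, ?_⟩
  rw [pow_one]
  change (L i : Uq n q) • x - (q : ℂ) ^ a i • x = 0
  rw [hx i, sub_self]

theorem IsNatural.isInternal (hv : IsNatural q v) (hq : ¬ IsOfFinOrder q) :
    DirectSum.IsInternal (weightSpace n q V) := by
  refine DirectSum.isInternal_submodule_of_iSupIndep_of_iSup_eq_top
    (iSupIndep_weightSpace hq V) ?_
  rw [eq_top_iff, ← v.span_eq, Submodule.span_le]
  rintro _ ⟨i, rfl⟩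
  exact Submodule.mem_iSup_of_mem (eps i) (mem_weightSpace.2 (hv.isWt i))

theorem IsNatural.inO (hv : IsNatural q v) (hq : ¬ IsOfFinOrder q) : InO n q V := by
  classical
  have hfin : Module.Finite ℂ V := Module.Finite.of_basis v
  refine ⟨fun x => inferInstance, fun a => inferInstance, hv.isInternal hq, ?_⟩
  refine ⟨⟨Finset.univ.image v, ?_⟩⟩
  rw [eq_top_iff]
  intro x _
  rw [← v.sum_repr x]
  refine Submodule.sum_mem _ fun i _ => complex_smul_mem _ _ (Submodule.subset_span ?_)
  simp

theorem IsNatural.weightProj_basis (hv : IsNatural q v) (hq : ¬ IsOfFinOrder q) (a : Weight n)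
    (i : Fin n) : weightProj n q V a (v i) = if eps i = a then v i else 0 :=
  weightProj_of_mem n q (hv.isInternal hq) a (mem_weightSpace.2 (hv.isWt i))

theorem eps_injective : Function.Injective (eps : Fin n → Weight n) := fun i j h => by
  have := congrFun h i
  by_contra hij
  simp [eps, hij] at this

/-- The map `Π⁻¹` on the tensor square of the natural module, as a linear map. -/
theorem IsNatural.exists_PiInv_eq (hv : IsNatural q v) (hq : ¬ IsOfFinOrder q) :
    ∃ f : Tens n q V V →ₗ[ℂ] Tens n q V V, (∀ x, PiInv n q V V x = f x) ∧
      ∀ i j, f (vv q v i j) = (if i = j then (q : ℂ) else 1) • vv q v j i := by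
  let f : V ⊗[ℂ] V →ₗ[ℂ] V ⊗[ℂ] V := ∑ p : Fin n × Fin n, (q : ℂ) ^ form (eps p.1) (eps p.2) •
    ((TensorProduct.comm ℂ V V).toLinearMap ∘ₗ
      TensorProduct.map (weightProj n q V (eps p.1)) (weightProj n q V (eps p.2)))
  have hf : ∀ x, PiInv n q V V x = f x := by
    intro x
    -- Only the weights `ε_i` occur in `V`, so the sum over all pairs of weights is a finite sum of
    -- linear maps, uniformly in `x`.
    have hsupp : ∀ a : Weight n, a ∉ Set.range eps → weightProj n q V a = 0 := by
      intro a ha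
      refine v.ext fun i => ?_
      rw [hv.weightProj_basis hq, if_neg fun h => ha ⟨i, h⟩, LinearMap.zero_apply]
    have hinj : Function.Injective fun p : Fin n × Fin n => ((eps p.1, eps p.2) : Weight n × Weight n) :=
      fun p p' h => Prod.ext (eps_injective (congrArg Prod.fst h))
        (eps_injective (congrArg Prod.snd h))
    classical
    rw [PiInv, finsum_eq_sum_of_support_subset (s := Finset.univ.map ⟨_, hinj⟩), Finset.sum_map]
    · simp only [f, LinearMap.sum_apply, LinearMap.smul_apply, LinearMap.comp_apply]
      rfl
    · rintro ⟨a, b⟩ hab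
      by_contra hno
      refine hab ?_
      have h : a ∉ Set.range eps ∨ b ∉ Set.range eps := by
        by_contra! h
        obtain ⟨⟨i, rfl⟩, ⟨j, rfl⟩⟩ := h
        exact hno (by simp)
      dsimp only
      rcases h with h | h
      · rw [hsupp a h, TensorProduct.map_zero_left, LinearMap.zero_apply, map_zero, smul_zero]
      · rw [hsupp b h, TensorProduct.map_zero_right, LinearMap.zero_apply, map_zero, smul_zero]
  refine ⟨f, hf, fun i j => ?_⟩
  refine (hf (v i ⊗ₜ v j)).symm.trans ((PiInv_tmul n q V V (hv.isInternal hq) (hv.isInternal hq)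
    (mem_weightSpace.2 (hv.isWt i)) (mem_weightSpace.2 (hv.isWt j))).trans ?_)
  rw [form_eps]
  by_cases h : i = j
  · subst h; simp [eps]; rfl
  · simp [eps, h, Ne.symm h]; rfl

end CategoryO

/-! ### Every R-matrix family induces the explicit operator -/

section Uniqueness

variable {n : ℕ} {q : ℂˣ} {V : Type} [AddCommGroup V] [Module ℂ V] [Module (Uq n q) V]
  [IsScalarTower ℂ (Uq n q) V] {v : Module.Basis (Fin n) ℂ V}

/-- The vectors `v_i ⊗ v_0` generate `V ⊗ V`. -/
theorem IsNatural.eq_top_of_vv_mem (hv : IsNatural q v) (hn : 0 < n)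
    (N : Submodule (Uq n q) (Tens n q V V)) (h : ∀ i, vv q v i ⟨0, hn⟩ ∈ N) : N = ⊤ := by
  have hall : ∀ (m : ℕ) (hm : m < n) (i : Fin n), vv q v i ⟨m, hm⟩ ∈ N := by
    intro m
    induction m with
    | zero => exact fun _ => h
    | succ m ih =>
      intro hm i
      let k : Fin (n - 1) := ⟨m, by omega⟩
      have h1 : (F k : Uq n q) • vv q v i (lo k) ∈ N := N.smul_mem _ (ih _ i)
      -- `F_k (v_i ⊗ v_m)` is `v_i ⊗ v_{m+1}` plus a term whose second factor is still `v_m`,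
      -- already in `N` by induction.
      rw [hv.F_smul_vv, if_pos rfl] at h1
      refine (N.add_mem_iff_right (complex_smul_mem N _ ?_)).1 h1
      split_ifs
      · exact ih _ _
      · exact N.zero_mem
  rw [eq_top_iff]
  intro x _
  rw [← (tensBasis q v).sum_repr x]
  refine N.sum_mem fun p _ => complex_smul_mem N _ ?_
  rw [tensBasis_apply]
  exact hall p.2 p.2.2 p.1

/-- The terms of nonzero degree of an `R`-matrix family kill `x ⊗ v_0`. -/
theorem IsNatural.tensorAct_eq_zero (hv : IsNatural q v) (hn : 0 < n) {ν : Fin (n - 1) → ℕ}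
    (hν : ν ≠ 0) {z : Uq n q ⊗[ℂ] Uq n q}
    (hz : z ∈ Submodule.map₂ (TensorProduct.mk ℂ (Uq n q) (Uq n q))
      (UminusDeg n q ν) (UplusDeg n q ν)) (x : V) :
    tensorAct n q V V z (x ⊗ₜ v ⟨0, hn⟩) = 0 := by
  have hplus : ∀ u ∈ UplusDeg n q ν, u • v ⟨0, hn⟩ = 0 := by
    intro u hu
    induction hu using Submodule.span_induction with
    | mem u hu =>
      obtain ⟨w, hw, rfl⟩ := hu
      -- A word of nonzero degree has a last letter, which acts first and kills `v_0`.
      rcases List.eq_nil_or_concat w with rfl | ⟨w', k, rfl⟩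
      · exact absurd (funext fun k => by simpa using (hw k).symm) hν
      · rw [List.concat_eq_append, List.map_append, List.prod_append, List.map_singleton,
          List.prod_singleton, mul_smul, hv.E_smul, if_neg (by simp [hi]), smul_zero]
    | zero => exact zero_smul _ _
    | add a b _ _ ha hb => rw [add_smul, ha, hb, add_zero]
    | smul c a _ ha => rw [smul_assoc, ha, smul_zero]
  have hle : Submodule.map₂ (TensorProduct.mk ℂ (Uq n q) (Uq n q))
      (UminusDeg n q ν) (UplusDeg n q ν) ≤ LinearMap.ker
        (LinearMap.applyₗ (x ⊗ₜ[ℂ] v ⟨0, hn⟩) ∘ₗ (tensorAct n q V V).toLinearMap) := by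
    refine Submodule.map₂_le.2 fun a _ b hb => ?_
    rw [LinearMap.mem_ker]
    change tensorAct n q V V (a ⊗ₜ b) (x ⊗ₜ v ⟨0, hn⟩) = 0
    rw [tensorAct_tmul, hplus b hb, TensorProduct.tmul_zero]
  exact hle hz

theorem IsNatural.braiding_eq (hv : IsNatural q v) (hq : ¬ IsOfFinOrder q) (hn : 0 < n)
    {P : (Fin (n - 1) → ℕ) → Uq n q ⊗[ℂ] Uq n q} (hP : IsRMatrixFamily n q P) :
    braiding n q V V P = rMap q v := by
  obtain ⟨e, he⟩ := hP.iso V V (hv.inO hq) (hv.inO hq)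
  obtain ⟨f, hf, hfv⟩ := hv.exists_PiInv_eq hq
  -- The vectors on which two `U_q`-linear maps agree form a submodule, so the generators `v_i ⊗
  -- v_0` suffice. On them no term `i < j` of `rMap` occurs.
  have h : LinearMap.eqLocus e.toLinearMap hv.rEquiv.toLinearMap = ⊤ := by
    refine hv.eq_top_of_vv_mem hn _ fun i => ?_
    rw [LinearMap.mem_eqLocus]
    change e (vv q v i ⟨0, hn⟩) = rMap q v (vv q v i ⟨0, hn⟩)
    have hsum : ∑ᶠ ν, tensorAct n q V V (P ν) (v i ⊗ₜ v ⟨0, hn⟩) = v i ⊗ₜ v ⟨0, hn⟩ := by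
      rw [finsum_eq_single _ 0, hP.zero, map_one, Module.End.one_apply]
      exact fun ν hν => hv.tensorAct_eq_zero hn hν (hP.mem ν) _
    rw [he, rMap_vv, if_neg (c := i < ⟨0, hn⟩) (by simp [Fin.lt_def]), zero_smul, add_zero, ← hfv]
    exact (congrArg (PiInv n q V V) hsum).trans (hf _)
  rw [← he]
  funext x
  have hx : x ∈ LinearMap.eqLocus e.toLinearMap hv.rEquiv.toLinearMap := h ▸ Submodule.mem_top
  exact hx

end Uniqueness

/-! ### The closed formula on the tensor square of the natural module -/

section UniversalR

variable {n : ℕ} {q : ℂˣ} {V : Type*} [AddCommGroup V] [Module ℂ V] [Module (Uq n q) V]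
  [IsScalarTower ℂ (Uq n q) V] {v : Module.Basis (Fin n) ℂ V}

theorem IsNatural.natE_smul (hv : IsNatural q v) {k : ℕ} (hk : k + 1 < n) (l : Fin n) :
    natE n q k • v l = if (l : ℕ) = k + 1 then v ⟨k, by omega⟩ else 0 := by
  rw [natE, dif_pos (by omega), hv.E_smul]
  simp only [Fin.ext_iff, hi, lo]

theorem IsNatural.natF_smul (hv : IsNatural q v) {k : ℕ} (hk : k + 1 < n) (l : Fin n) :
    natF n q k • v l = if (l : ℕ) = k then v ⟨k + 1, hk⟩ else 0 := by
  rw [natF, dif_pos (by omega), hv.F_smul]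
  simp only [Fin.ext_iff, hi, lo]

/-- A product of matrix units: in the `q`-commutator only the first product survives, so the
coefficient `-q⁻¹` plays no role. -/
theorem IsNatural.rootE_smul (hv : IsNatural q v) (i : ℕ) : ∀ (d : ℕ) (hd : i + d + 1 < n)
    (l : Fin n), rootE n q i d • v l = if (l : ℕ) = i + d + 1 then v ⟨i, by omega⟩ else 0
  | 0, hd, l => hv.natE_smul hd l
  | d + 1, hd, l => by
    rw [rootE, sub_smul, smul_assoc, mul_smul, mul_smul, hv.natE_smul (by omega),
      hv.rootE_smul i d (by omega), smul_ite, smul_ite, hv.natE_smul (by omega),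
      hv.rootE_smul i d (by omega)]
    simp only [if_true, smul_zero]
    rw [if_neg (by omega : ¬ i = i + d + 1 + 1), ite_self, smul_zero, sub_zero]
    rfl

theorem IsNatural.rootF_smul (hv : IsNatural q v) (i : ℕ) : ∀ (d : ℕ) (hd : i + d + 1 < n)
    (l : Fin n), rootF n q i d • v l = if (l : ℕ) = i then v ⟨i + d + 1, hd⟩ else 0
  | 0, hd, l => hv.natF_smul hd l
  | d + 1, hd, l => by
    rw [rootF, sub_smul, smul_assoc, mul_smul, mul_smul, hv.natF_smul (by omega),
      hv.rootF_smul i d (by omega), smul_ite, smul_ite, hv.natF_smul (by omega),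
      hv.rootF_smul i d (by omega)]
    simp only [if_true, smul_zero]
    rw [if_neg (by omega : ¬ i + d + 1 + 1 = i), ite_self, smul_zero, sub_zero]
    rfl

variable (n q) in
/-- The element `F_{ij} ⊗ E_{ij}`, for a pair `p = (i, j)`. -/
def rootTensor (p : Fin n × Fin n) : Uq n q ⊗[ℂ] Uq n q :=
  rootF n q p.1 ((p.2 : ℕ) - p.1 - 1) ⊗ₜ rootE n q p.1 ((p.2 : ℕ) - p.1 - 1)

theorem IsNatural.rootTensor_apply (hv : IsNatural q v) {p : Fin n × Fin n} (hp : p.1 < p.2)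
    (a b : Fin n) : tensorAct n q V V (rootTensor n q p) (v a ⊗ₜ v b) =
      if p = (a, b) then v p.2 ⊗ₜ v p.1 else 0 := by
  obtain ⟨i, j⟩ := p
  have hij : (i : ℕ) < j := hp
  have hd : (i : ℕ) + (j - i - 1) + 1 = j := by omega
  rw [rootTensor, tensorAct_tmul, hv.rootF_smul i (j - i - 1) (by omega),
    hv.rootE_smul i (j - i - 1) (by omega)]
  simp only [hd, Fin.eta, ← Fin.ext_iff, Prod.mk.injEq, eq_comm (a := a), eq_comm (a := b)]
  by_cases ha : i = a <;> by_cases hb : j = b <;> simp [ha, hb]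

/-- The image of the second operator is spanned by a tensor `v_j ⊗ v_i` with `i < j`, while the
first one kills every basis tensor whose indices are not increasing. -/
theorem IsNatural.rootTensor_mul (hv : IsNatural q v) {p p' : Fin n × Fin n} (hp : p.1 < p.2)
    (hp' : p'.1 < p'.2) : tensorAct n q V V (rootTensor n q p) *
      tensorAct n q V V (rootTensor n q p') = 0 := by
  refine (v.tensorProduct v).ext fun ⟨a, b⟩ => ?_
  rw [Module.Basis.tensorProduct_apply, Module.End.mul_apply, hv.rootTensor_apply hp',
    LinearMap.zero_apply]
  split_ifs with h
  · rw [hv.rootTensor_apply hp, if_neg]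
    rintro rfl
    exact lt_asymm hp hp'
  · rw [map_zero]

theorem expCoeff_zero : expCoeff q 0 = 1 := by simp [expCoeff]

theorem expCoeff_one (hq : ¬ IsOfFinOrder q) : expCoeff q 1 = (q : ℂ) - (q : ℂ)⁻¹ := by
  have := sub_inv_ne_zero hq
  simp [expCoeff, this]

/-- A product of terms of `q`-exponentials whose arguments multiply to zero. -/
theorem prod_expCoeff_smul {A ι : Type*} [Ring A] [Algebra ℂ A] [DecidableEq ι] {T : ι → A}
    (m : ι → ℕ) {l : List ι} (hl : l.Nodup) (hT : ∀ p ∈ l, ∀ p' ∈ l, T p * T p' = 0) :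
    ((∀ p ∈ l, m p = 0) ∧ (l.map fun p => expCoeff q (m p) • T p ^ m p).prod = 1) ∨
    (∃ p ∈ l, (∀ p' ∈ l, m p' = if p' = p then 1 else 0) ∧
      (l.map fun p => expCoeff q (m p) • T p ^ m p).prod = expCoeff q 1 • T p) ∨
    (l.map fun p => expCoeff q (m p) • T p ^ m p).prod = 0 := by
  induction l with
  | nil => exact Or.inl ⟨by simp, by simp⟩
  | cons a l ih =>
    rw [List.nodup_cons] at hl
    rw [List.map_cons, List.prod_cons]
    have ih := ih hl.2 fun p hp p' hp' => hT p (by simp [hp]) p' (by simp [hp'])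
    have hne : ∀ p ∈ l, p ≠ a := fun p hp h => hl.1 (h ▸ hp)
    rcases Nat.lt_trichotomy (m a) 1 with ha | ha | ha
    · have ha : m a = 0 := by omega
      rw [ha, pow_zero, expCoeff_zero, one_smul, one_mul]
      rcases ih with ⟨h0, h⟩ | ⟨p, hp, h1, h⟩ | h
      · exact Or.inl ⟨by simpa [ha] using h0, h⟩
      · refine Or.inr (Or.inl ⟨p, by simp [hp], ?_, h⟩)
        rintro p' (_ | ⟨_, hp'⟩)
        · rw [ha, if_neg (hne p hp).symm]
        · exact h1 p' hp'
      · exact Or.inr (Or.inr h)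
    · rw [ha, pow_one]
      rcases ih with ⟨h0, h⟩ | ⟨p, hp, h1, h⟩ | h
      · refine Or.inr (Or.inl ⟨a, by simp, ?_, by rw [h, mul_one]⟩)
        rintro p' (_ | ⟨_, hp'⟩)
        · rw [ha, if_pos rfl]
        · rw [h0 p' hp', if_neg (hne p' hp')]
      · refine Or.inr (Or.inr ?_)
        rw [h, smul_mul_smul_comm, hT a (by simp) p (by simp [hp]), smul_zero]
      · exact Or.inr (Or.inr (by rw [h, mul_zero]))
    -- An exponent at least `2` contains the square of `T a`, which is zero.
    · refine Or.inr (Or.inr ?_)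
      obtain ⟨r, hr⟩ : ∃ r, m a = r + 2 := ⟨m a - 2, by omega⟩
      rw [hr, pow_add, pow_two, hT a (by simp) a (by simp), mul_zero, smul_zero, zero_mul]

theorem prod_map_ite_one {A ι : Type*} [Monoid A] [DecidableEq ι] (x : A) {p : ι} {l : List ι}
    (hl : l.Nodup) (hp : p ∈ l) : (l.map fun p' => if p' = p then x else 1).prod = x := by
  induction l with
  | nil => simp at hp
  | cons a l ih =>
    rw [List.nodup_cons] at hl
    rw [List.map_cons, List.prod_cons]
    by_cases h : a = p
    · subst h
      rw [if_pos rfl, List.prod_eq_one, mul_one]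
      intro y hy
      obtain ⟨p', hp', rfl⟩ := List.mem_map.1 hy
      exact if_neg fun h : p' = a => hl.1 (h ▸ hp')
    · rw [if_neg h, one_mul]
      exact ih hl.2 ((List.mem_cons.1 hp).resolve_left (Ne.symm h))

theorem mem_posRoots {p : Fin n × Fin n} : p ∈ posRoots n ↔ p.1 < p.2 := by
  obtain ⟨i, j⟩ := p
  have h : (i, j) ∈ List.finRange n ×ˢ List.finRange n :=
    List.pair_mem_product.2 ⟨List.mem_finRange i, List.mem_finRange j⟩
  simp [posRoots, h]

theorem nodup_posRoots : (posRoots n).Nodup :=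
  ((List.nodup_finRange n).product (List.nodup_finRange n)).filter _

variable (n q) in
/-- The product of the terms of degrees `m p` of the `q`-exponentials. -/
def rTerm (m : Fin n × Fin n → ℕ) : Uq n q ⊗[ℂ] Uq n q :=
  ((posRoots n).map fun p => expCoeff q (m p) • rootTensor n q p ^ m p).prod

variable (n) in
/-- The exponents that contribute to the degree `ν`. -/
def expSet (ν : Fin (n - 1) → ℕ) : Set (Fin n × Fin n → ℕ) :=
  {m | (∀ p, ¬ p.1 < p.2 → m p = 0) ∧ rootDeg n m = ν}

/-- The root of `p` contains the simple root at `p.1`, so each exponent is bounded by an entry of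
`ν`. Finiteness lets the action pass through the `finsum` that defines `universalR`. -/
theorem finite_expSet (ν : Fin (n - 1) → ℕ) : (expSet n ν).Finite := by
  refine (Set.finite_Iic (fun _ : Fin n × Fin n => ∑ k, ν k)).subset fun m hm p => ?_
  by_cases hp : p.1 < p.2
  · have hp' : (p.1 : ℕ) < p.2 := hp
    let k : Fin (n - 1) := ⟨p.1, by omega⟩
    have h1 : m p ≤ ν k := by
      rw [← hm.2, rootDeg]
      refine le_trans ?_ (Finset.single_le_sum (fun _ _ => Nat.zero_le _) (Finset.mem_univ p))
      rw [if_pos ⟨le_rfl, hp⟩]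
    exact h1.trans (Finset.single_le_sum (fun _ _ => Nat.zero_le _) (Finset.mem_univ k))
  · rw [hm.1 p hp]; exact Nat.zero_le _

theorem universalR_eq (ν : Fin (n - 1) → ℕ) :
    universalR n q ν = ∑ᶠ m ∈ expSet n ν, rTerm n q m := by
  simp only [rTerm, rootTensor, Algebra.TensorProduct.tmul_pow]
  rfl

variable (n) in
/-- The exponents whose terms act on the tensor square of the natural module. -/
def smallExp : Finset (Fin n × Fin n → ℕ) :=
  insert 0 ((Finset.univ.filter fun p : Fin n × Fin n => p.1 < p.2).image fun p => Pi.single p 1)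

theorem IsNatural.tensorAct_rTerm (hv : IsNatural q v) (m : Fin n × Fin n → ℕ) :
    ((∀ p ∈ posRoots n, m p = 0) ∧ tensorAct n q V V (rTerm n q m) = 1) ∨
    (∃ p ∈ posRoots n, (∀ p' ∈ posRoots n, m p' = if p' = p then 1 else 0) ∧
      tensorAct n q V V (rTerm n q m) =
        expCoeff q 1 • tensorAct n q V V (rootTensor n q p)) ∨
    tensorAct n q V V (rTerm n q m) = 0 := by
  have h := prod_expCoeff_smul (q := q) (T := fun p => tensorAct n q V V (rootTensor n q p)) m
    nodup_posRoots fun p hp p' hp' => hv.rootTensor_mul (mem_posRoots.1 hp) (mem_posRoots.1 hp')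
  have h2 : tensorAct n q V V (rTerm n q m) = ((posRoots n).map fun p =>
      expCoeff q (m p) • tensorAct n q V V (rootTensor n q p) ^ m p).prod := by
    rw [rTerm, map_list_prod, List.map_map]
    congr 1
    exact List.map_congr_left fun p _ => by
      rw [Function.comp_apply, map_smul, map_pow]
  rwa [h2]

theorem IsNatural.mem_smallExp (hv : IsNatural q v) {m : Fin n × Fin n → ℕ}
    (hm : ∀ p, ¬ p.1 < p.2 → m p = 0) (h : tensorAct n q V V (rTerm n q m) ≠ 0) :
    m ∈ smallExp n := by
  rw [smallExp, Finset.mem_insert, Finset.mem_image]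
  rcases hv.tensorAct_rTerm m with ⟨h0, -⟩ | ⟨p, hp, h1, -⟩ | h'
  · refine Or.inl (funext fun p => ?_)
    by_cases hp : p.1 < p.2
    · exact h0 p (mem_posRoots.2 hp)
    · exact hm p hp
  · refine Or.inr ⟨p, by simpa using mem_posRoots.1 hp, funext fun p' => ?_⟩
    rw [Pi.single_apply]
    by_cases hp' : p'.1 < p'.2
    · exact (h1 p' (mem_posRoots.2 hp')).symm
    · rw [hm p' hp', if_neg]
      rintro rfl
      exact hp' (mem_posRoots.1 hp)
  · exact absurd h' h

theorem smallExp_support {m : Fin n × Fin n → ℕ} (hm : m ∈ smallExp n) :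
    ∀ p, ¬ p.1 < p.2 → m p = 0 := by
  rw [smallExp, Finset.mem_insert, Finset.mem_image] at hm
  intro p hp
  rcases hm with rfl | ⟨p', hp', rfl⟩
  · rfl
  · rw [Pi.single_apply, if_neg]
    rintro rfl
    exact hp (by simpa using hp')

/-- Exponents outside `smallExp` act by zero, so one finite index set serves all degrees `ν`. -/
theorem IsNatural.tensorAct_universalR (hv : IsNatural q v) (ν : Fin (n - 1) → ℕ) :
    tensorAct n q V V (universalR n q ν) =
      ∑ m ∈ smallExp n, if rootDeg n m = ν then tensorAct n q V V (rTerm n q m) else 0 := by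
  classical
  have h := AddMonoidHom.map_finsum_mem (rTerm n q)
    (tensorAct n q V V).toRingHom.toAddMonoidHom (finite_expSet ν)
  rw [universalR_eq]
  refine h.trans ?_
  rw [finsum_mem_def, finsum_eq_sum_of_support_subset (s := smallExp n)]
  · refine Finset.sum_congr rfl fun m hm => ?_
    rw [Set.indicator_apply]
    refine if_congr ⟨fun h => h.2, fun h => ⟨smallExp_support hm, h⟩⟩ rfl rfl
  · intro m hm
    rw [Function.mem_support, Set.indicator_apply] at hm
    have hmem : m ∈ expSet n ν := by
      by_contra h
      exact hm (if_neg h)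
    rw [if_pos hmem] at hm
    exact hv.mem_smallExp hmem.1 hm

theorem IsNatural.finsum_universalR (hv : IsNatural q v) (x : V ⊗[ℂ] V) :
    ∑ᶠ ν, tensorAct n q V V (universalR n q ν) x =
      ∑ m ∈ smallExp n, tensorAct n q V V (rTerm n q m) x := by
  have h : ∀ m (ν : Fin (n - 1) → ℕ), ν ≠ rootDeg n m →
      (if rootDeg n m = ν then tensorAct n q V V (rTerm n q m) else 0) x = 0 := fun m ν hν => by
    rw [if_neg hν.symm, LinearMap.zero_apply]
  simp only [hv.tensorAct_universalR, LinearMap.sum_apply]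
  -- After the exchange each exponent contributes only to its own degree.
  rw [finsum_sum_comm]
  · refine Finset.sum_congr rfl fun m _ => ?_
    rw [finsum_eq_single _ (rootDeg n m) (h m), if_pos rfl]
  · intro m _
    refine (Set.finite_singleton (rootDeg n m)).subset fun ν hν => ?_
    by_contra hne
    exact hν (h m ν hne)

theorem IsNatural.sum_rTerm (hv : IsNatural q v) (hq : ¬ IsOfFinOrder q) (a b : Fin n) :
    ∑ m ∈ smallExp n, tensorAct n q V V (rTerm n q m) (v a ⊗ₜ v b) = v a ⊗ₜ v b +
      (if a < b then (q : ℂ) - (q : ℂ)⁻¹ else 0) • (v b ⊗ₜ v a) := by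
  have hinj : Function.Injective fun p : Fin n × Fin n => (Pi.single p 1 : Fin n × Fin n → ℕ) := by
    intro p p' h
    have := congrFun h p
    by_contra hne
    simp [hne] at this
  have h0 : tensorAct n q V V (rTerm n q 0) = 1 := by
    have : rTerm n q (0 : Fin n × Fin n → ℕ) = 1 := by
      simp [rTerm, expCoeff_zero]
    rw [this, map_one]
  have h1 : ∀ p : Fin n × Fin n, p.1 < p.2 → tensorAct n q V V (rTerm n q (Pi.single p 1)) =
      expCoeff q 1 • tensorAct n q V V (rootTensor n q p) := by
    intro p hp
    rw [rTerm, ← map_smul, ← prod_map_ite_one (expCoeff q 1 • rootTensor n q p) nodup_posRoots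
      (mem_posRoots.2 hp)]
    congr 3
    funext p'
    rw [Pi.single_apply]
    split_ifs with h
    · rw [h, pow_one]
    · rw [expCoeff_zero, pow_zero, one_smul]
  rw [smallExp, Finset.sum_insert, h0, Module.End.one_apply, Finset.sum_image hinj.injOn]
  · congr 1
    rw [Finset.sum_congr rfl (g := fun p => if p = (a, b) then
      ((q : ℂ) - (q : ℂ)⁻¹) • (v b ⊗ₜ[ℂ] v a) else 0), Finset.sum_ite_eq']
    · simp only [Finset.mem_filter, Finset.mem_univ, true_and]
      split_ifs
      · rfl
      · rw [zero_smul]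
    · intro p hp
      have hp : p.1 < p.2 := by simpa using hp
      rw [h1 p hp, LinearMap.smul_apply, hv.rootTensor_apply hp, expCoeff_one hq]
      split_ifs with h
      · rw [h]
      · rw [smul_zero]
  · rw [Finset.mem_image]
    rintro ⟨p, -, hp⟩
    have := congrFun hp p
    simp at this

theorem IsNatural.braiding_universalR (hv : IsNatural q v) (hq : ¬ IsOfFinOrder q) :
    braiding n q V V (universalR n q) = rMap q v := by
  obtain ⟨f, hf, hfv⟩ := hv.exists_PiInv_eq hq
  let g : V ⊗[ℂ] V →ₗ[ℂ] V ⊗[ℂ] V := ∑ m ∈ smallExp n, tensorAct n q V V (rTerm n q m)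
  have hg : ∀ x : V ⊗[ℂ] V, braiding n q V V (universalR n q) x = f (g x) := by
    intro x
    have hgx : g x = ∑ m ∈ smallExp n, tensorAct n q V V (rTerm n q m) x :=
      LinearMap.sum_apply _ _ _
    exact (congrArg (PiInv n q V V) ((hv.finsum_universalR x).trans hgx.symm)).trans (hf _)
  -- The same map, viewed on the type that carries the action through the coproduct, so that it can
  -- be compared with `rMap`.
  let g' : Tens n q V V →ₗ[ℂ] Tens n q V V := g
  have h : f ∘ₗ g' = rMap q v := by
    refine (tensBasis q v).ext fun ⟨a, b⟩ => ?_
    have h1 : g (v a ⊗ₜ v b) = vv q v a b +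
        (if a < b then (q : ℂ) - (q : ℂ)⁻¹ else 0) • vv q v b a :=
      (LinearMap.sum_apply _ _ _).trans (hv.sum_rTerm hq a b)
    rw [tensBasis_apply, rMap_vv]
    refine (congrArg f h1).trans ?_
    rw [map_add, map_smul, hfv, hfv]
    congr 1
    split_ifs with h1 h2
    · exact absurd h2 h1.ne'
    · rw [one_smul]
    all_goals rw [zero_smul, zero_smul]
  exact funext fun x => (hg x).trans (LinearMap.congr_fun h x)

end UniversalR

end QuantumGL

end

/-! ### The main theorem -/

theorem mainTheorem8 (n : ℕ) (hn : 0 < n) (q : ℂˣ) (hq : ¬ IsOfFinOrder q) :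
    let V := QuantumGL.Simple n q (QuantumGL.eps ⟨0, hn⟩)
    let R : QuantumGL.Tens n q V V → QuantumGL.Tens n q V V :=
      QuantumGL.braiding n q V V (QuantumGL.universalR n q)
    (∀ P : (Fin (n - 1) → ℕ) → TensorProduct ℂ (QuantumGL.Uq n q) (QuantumGL.Uq n q),
      QuantumGL.IsRMatrixFamily n q P → QuantumGL.braiding n q V V P = R) ∧
    (∃ e : QuantumGL.Tens n q V V ≃ₗ[QuantumGL.Uq n q] QuantumGL.Tens n q V V, ⇑e = R) ∧
    (R - (q : ℂ) • id) ∘ (R + (q : ℂ)⁻¹ • id) = 0 ∧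
    ∃ A B : Submodule (QuantumGL.Uq n q) (QuantumGL.Tens n q V V),
      IsCompl A B ∧
      Nonempty (A ≃ₗ[QuantumGL.Uq n q]
        QuantumGL.Simple n q (2 • QuantumGL.eps ⟨0, hn⟩)) ∧
      (∀ h : 2 ≤ n, Nonempty (B ≃ₗ[QuantumGL.Uq n q]
        QuantumGL.Simple n q (QuantumGL.eps ⟨0, hn⟩ + QuantumGL.eps ⟨1, h⟩))) ∧
      (n = 1 → B = ⊥) ∧
      (∀ x ∈ A, R x = (q : ℂ) • x) ∧
      (∀ x ∈ B, R x = -(q : ℂ)⁻¹ • x) := by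
  intro V R
  obtain ⟨v, hv⟩ := QuantumGL.exists_isNatural hq hn
  have hR : R = QuantumGL.rMap q v := hv.braiding_universalR hq
  refine ⟨fun P hP => (hv.braiding_eq hq hn hP).trans hR.symm, ⟨hv.rEquiv, hR.symm⟩, ?_,
    hv.eigen (q : ℂ), hv.eigen (-(q : ℂ)⁻¹), hv.isCompl_eigen hq, hv.nonempty_eigen_q hq hn,
    fun h => hv.nonempty_eigen_neg_q_inv hq h, hv.eigen_eq_bot hq, fun x hx => ?_, fun x hx => ?_⟩
  · funext x
    have h : QuantumGL.rMap q v (QuantumGL.rMap q v x + (q : ℂ)⁻¹ • x) -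
        (q : ℂ) • (QuantumGL.rMap q v x + (q : ℂ)⁻¹ • x) = 0 := by
      have h0 := q.ne_zero
      rw [map_add, map_smul, QuantumGL.rMap_rMap]
      match_scalars <;> field_simp <;> ring
    rw [hR]
    exact h
  · rw [hR]
    exact hx
  · rw [hR]
    exact hx
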